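/- Call a random function $F$ on a probability space $(\Omega,\mathbb P)$ a Gaussian Entire Function (G.E.F.) if, almost surely, $F(z)=\sum_{n\ge 0}\zeta_n \frac{z^n}{\sqrt{n!}}$ for all $z\in\mathbb C$, where $\zeta_0,\zeta_1,\dots$ are independent standard complex Gaussian random variables on $\Omega$ (with density $\frac1\pi e^{-|\zeta|^2}$ with respect to Lebesgue measure on $\mathbb C$). For a function $f$ on $\mathbb C$ put $f^*(z)=f(z)e^{-|z|^2/2}$. Theorem (Almost independence). There exist numerical constants $A>1$ and $C>0$ with the following property. Let $F$ be a G.E.F. on a probability space $(\Omega,\mathbb P)$, let $(K_j)$ be a family (finite or infinite) of non-empty compact subsets of $\mathbb C$ with diameters $d(K_j)$, and let $\lambda_j\ge\max\{d(K_j),2\}$ be real numbers such that the (open) $A\sqrt{\log\lambda_j}$-neighbourhoods of the sets $K_j$ are pairwise disjoint. Then there are random functions $F_j$ and $G_j$ on $\Omega$ such that the $F_j$ are independent G.E.F.s, for every $j$ $$F^*=F_j^*+G_j^*\qquad\text{on } K_j,$$ and for every $j$ $$\mathbb P\Bigl\{\max_{K_j}|G_j^*|\ge\lambda_j^{-1}\Bigr\}\le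 C\,e^{-\lambda_j}.$$ -/

import Mathlib

open MeasureTheory ProbabilityTheory

/-- The standard complex Gaussian distribution: the measure on `ℂ` whose density with respect to
Lebesgue measure is `π⁻¹ exp (-|ζ|²)`. -/
noncomputable def stdComplexGaussian : Measure ℂ :=
  (volume : Measure ℂ).withDensity
    (fun z => ENNReal.ofReal (Real.pi⁻¹ * Real.exp (-‖z‖ ^ 2)))

/-- A random function `F : Ω → ℂ → ℂ` on the probability space `(Ω, μ)` is a Gaussian Entire
Function if there are independent standard complex Gaussian random variables `ζ 0, ζ 1, …` on
`(Ω, μ)` such that almost surely `F(z) = ∑ ζ n * z ^ n / √(n!)` for all `z`. -/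
structure IsGEF {Ω : Type*} [MeasurableSpace Ω] (F : Ω → ℂ → ℂ) (μ : Measure Ω) : Prop where
  measurable_eval : ∀ z : ℂ, Measurable (fun ω => F ω z)
  exists_coeff : ∃ ζ : ℕ → Ω → ℂ,
    (∀ n, Measurable (ζ n)) ∧
    (∀ n, μ.map (ζ n) = stdComplexGaussian) ∧
    iIndepFun ζ μ ∧
    ∀ᵐ ω ∂μ, ∀ z : ℂ,
      HasSum (fun n : ℕ => ζ n ω * (z ^ n / (Real.sqrt (n.factorial : ℝ) : ℂ))) (F ω z)

/-- The normalization `f*(z) = f(z) exp (-|z|² / 2)`. -/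
noncomputable def normalized (f : ℂ → ℂ) (z : ℂ) : ℂ :=
  f z * (Real.exp (-(‖z‖ ^ 2) / 2) : ℂ)

/-!
Near a compact set `K`, the normalized Gaussian entire function `F*` depends, up to a tiny error,
only on the white noise inside a neighbourhood of `K`. Indeed, in the Bargmann representation the
vector attached to the value `F*(z)` is the function `w ↦ fockKernel w z / √π` in `L²(ℂ)`, a
Gaussian bump centred at `z` whose mass outside the disc of radius `R` is `exp (-R²)`.

Suppose first that `F` is the restriction to the Fock space of an isonormal process indexed by
`L²(ℂ × ℕ)`, where the Fock space sits on the sheet `ℂ × {0}`. Move the part of every bump that lies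
outside the neighbourhood `U j` of `K j` to a sheet reserved for `j`. In other words, lift
`L²(ℂ)` to the graph of the function that is `0` on `U j` and `enc j + 1` elsewhere. Each lift is an
isometry, so it produces an exact Gaussian entire function `Fj j`. The graphs for different `j`
are disjoint because the `U j` are, so the functions `Fj j` are independent. The difference between
the sheets has norm at most `2 exp (-R² / 2)` at the points of `K j`
(`norm_graphLift_sub_le`, `eLpNorm_indicator_bargmann_le`).

The given probability space need not carry any randomness besides `F`, so the additional white
noise has to be extracted from `F` itself (`IsIsonormal.exists_extension`). As the neighbourhoods
are open, disjoint and more than one, there is a point `p` outside all of them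
(`exists_forall_notMem_of_disjoint_open`), and the Gaussian `F*(p)` hardly influences `F*` on any of
the `K j`. This one Gaussian is replaced by the first term of an infinite sequence of independent
Gaussians computed from it (`exists_measurable_map_std_eq_infinitePi`), the other terms being the
new randomness. The replacement changes `F*` by a random multiple of `fockKernel p`, which is small
on every `K j`.

The maximum of the remaining error over `K j` is controlled by its moments of order `2 ⌈lam j⌉`.
By the mean value property of holomorphic functions, `|G*|ᵐ` at a point is at most a constant times
its integral over the unit disc around that point (`enorm_normalized_pow_le`); the Gaussian moments
are explicit (`IsIsonormal.lintegral_enorm_pow`); and Markov's inequality gives the exponential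
bound (`measure_exists_normalized_ge_le`, `moment_bound_le_exp`).
-/

open scoped ENNReal Topology

/-! ### The standard complex Gaussian distribution -/

theorem lintegral_withDensity_std (f : ℂ → ℝ≥0∞) :
    ∫⁻ z, f z ∂stdComplexGaussian =
      ∫⁻ z, ENNReal.ofReal (Real.pi⁻¹ * Real.exp (-‖z‖ ^ 2)) * f z := by
  rw [stdComplexGaussian, lintegral_withDensity_eq_lintegral_mul_non_measurable]
  · rfl
  · fun_prop
  · simp

/-- The even absolute moments of a standard complex Gaussian are the factorials. -/
theorem lintegral_enorm_pow_std (k : ℕ) :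
    ∫⁻ z, ‖z‖ₑ ^ (2 * k) ∂stdComplexGaussian = (k.factorial : ℝ≥0∞) := by
  have h := Complex.integral_rpow_mul_exp_neg_rpow (p := 2) (q := (2 * k : ℕ)) (by norm_num)
    (by have : (0 : ℝ) ≤ (2 * k : ℕ) := by positivity
        linarith)
  have hΓ : Real.Gamma ((((2 * k : ℕ) : ℝ) + 2) / 2) = k.factorial := by
    rw [← Real.Gamma_nat_eq_factorial]; congr 1; push_cast; ring
  rw [hΓ] at h
  have h' : ∫ z : ℂ, Real.pi⁻¹ * (‖z‖ ^ (((2 * k : ℕ) : ℝ)) * Real.exp (-‖z‖ ^ (2 : ℝ)))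
      = k.factorial := by
    rw [integral_const_mul, h]; field_simp
  rw [lintegral_withDensity_std]
  have hint : Integrable (fun z : ℂ =>
      Real.pi⁻¹ * (‖z‖ ^ (((2 * k : ℕ) : ℝ)) * Real.exp (-‖z‖ ^ (2 : ℝ)))) := by
    by_contra hn
    rw [integral_undef hn] at h'
    exact (Nat.cast_ne_zero (R := ℝ)).2 k.factorial_ne_zero h'.symm
  have := ofReal_integral_eq_lintegral_ofReal hint (ae_of_all _ fun z => by positivity)
  rw [h'] at this
  simp only [ENNReal.ofReal_natCast] at this
  rw [this]
  refine lintegral_congr fun z => ?_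
  rw [← ofReal_norm, ← ENNReal.ofReal_pow (norm_nonneg _),
    ← ENNReal.ofReal_mul (by positivity), Real.rpow_natCast, Real.rpow_two]
  ring_nf

instance : IsProbabilityMeasure stdComplexGaussian :=
  ⟨by simpa using lintegral_enorm_pow_std 0⟩

theorem charFun_std (t : ℂ) :
    charFun stdComplexGaussian t = Complex.exp (-((‖t‖ ^ 2 / 4 : ℝ) : ℂ)) := by
  have h := GaussianFourier.integral_cexp_neg_mul_sq_norm_add (V := ℂ) (b := 1) (by simp)
    Complex.I t
  rw [charFun_apply, stdComplexGaussian, integral_withDensity_eq_integral_toReal_smul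
    (by fun_prop) (by simp)]
  have e : ∀ z : ℂ, (ENNReal.ofReal (Real.pi⁻¹ * Real.exp (-‖z‖ ^ 2))).toReal •
      Complex.exp (inner ℝ z t * Complex.I) = (Real.pi : ℂ)⁻¹ *
      Complex.exp (-1 * (‖z‖ : ℂ) ^ 2 + Complex.I * (inner ℝ t z : ℝ)) := by
    intro z
    rw [ENNReal.toReal_ofReal (by positivity), Complex.exp_add, real_inner_comm]
    simp only [Complex.real_smul, Complex.ofReal_mul, Complex.ofReal_inv, Complex.ofReal_exp]
    push_cast
    ring_nf
  simp_rw [e]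
  rw [integral_const_mul, h, Complex.finrank_real_complex]
  have : (Real.pi : ℂ) ≠ 0 := by exact_mod_cast Real.pi_ne_zero
  simp only [Nat.cast_ofNat, ne_eq, OfNat.ofNat_ne_zero, not_false_eq_true, div_self, div_one,
    Complex.cpow_one, Complex.I_sq]
  rw [← mul_assoc, inv_mul_cancel₀ this]
  push_cast
  ring_nf

theorem integral_id_std : ∫ z, z ∂stdComplexGaussian = 0 := by
  rw [stdComplexGaussian, integral_withDensity_eq_integral_toReal_smul (by fun_prop) (by simp)]
  have h := integral_neg_eq_self (fun z : ℂ =>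
    (ENNReal.ofReal (Real.pi⁻¹ * Real.exp (-‖z‖ ^ 2))).toReal • z) volume
  simp only [norm_neg, smul_neg, integral_neg] at h
  exact self_eq_neg.1 h.symm

theorem lintegral_complex_polar {f : ℂ → ℝ≥0∞} (hf : Measurable f) :
    ∫⁻ z, f z = ∫⁻ r in Set.Ioi (0 : ℝ), ENNReal.ofReal r *
      ∫⁻ θ in Set.Ioo (-Real.pi) Real.pi, f (circleMap 0 r θ) := by
  rw [← Complex.lintegral_comp_polarCoord_symm, polarCoord_target, Measure.volume_eq_prod,
    ← Measure.prod_restrict, lintegral_prod]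
  · refine lintegral_congr fun r => ?_
    simp only [smul_eq_mul]
    rw [lintegral_const_mul]
    · simp [Complex.polarCoord_symm_apply, circleMap, Complex.exp_mul_I]
    · refine hf.comp ?_
      simp only [Complex.polarCoord_symm_apply]
      fun_prop
  · simp only [Complex.polarCoord_symm_apply, smul_eq_mul]
    have : Measurable fun p : ℝ × ℝ => (p.1 : ℂ) * (Real.cos p.2 + Real.sin p.2 * Complex.I) := by
      fun_prop
    exact ((by fun_prop : Measurable fun p : ℝ × ℝ => ENNReal.ofReal p.1).mul
      (hf.comp this)).aemeasurable

theorem std_tail {t : ℝ} (ht : 0 ≤ t) :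
    stdComplexGaussian {z | t ≤ ‖z‖} = ENNReal.ofReal (Real.exp (-t ^ 2)) := by
  have hm : MeasurableSet {z : ℂ | t ≤ ‖z‖} := measurableSet_le measurable_const measurable_norm
  have h1 := lintegral_withDensity_std ({z : ℂ | t ≤ ‖z‖}.indicator 1)
  rw [lintegral_indicator_one hm] at h1
  rw [h1, lintegral_complex_polar]
  swap
  · exact (by fun_prop : Measurable fun z : ℂ =>
      ENNReal.ofReal (Real.pi⁻¹ * Real.exp (-‖z‖ ^ 2))).mul (measurable_one.indicator hm)
  have h2 : ∫⁻ r in Set.Ioi t, ENNReal.ofReal (2 * r * Real.exp (-r ^ 2)) =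
      ENNReal.ofReal (Real.exp (-t ^ 2)) := by
    have hd : ∀ x ∈ Set.Ici t, HasDerivAt (fun r : ℝ => -Real.exp (-r ^ 2))
        (2 * x * Real.exp (-x ^ 2)) x := by
      intro x _
      convert! (((hasDerivAt_id x).pow 2).neg.exp).neg using 1
      simp; ring
    have hl : Filter.Tendsto (fun r : ℝ => -Real.exp (-r ^ 2)) Filter.atTop (𝓝 0) := by
      rw [← neg_zero]
      refine (Real.tendsto_exp_atBot.comp ?_).neg
      exact Filter.tendsto_neg_atTop_atBot.comp (Filter.tendsto_pow_atTop two_ne_zero)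
    have hp : ∀ x ∈ Set.Ioi t, 0 ≤ 2 * x * Real.exp (-x ^ 2) := fun x hx => by
      have : 0 ≤ x := ht.trans (le_of_lt hx)
      positivity
    have i1 := integrableOn_Ioi_deriv_of_nonneg' hd hp hl
    have i2 := integral_Ioi_of_hasDerivAt_of_tendsto' hd i1 hl
    rw [← ofReal_integral_eq_lintegral_ofReal i1
      ((ae_restrict_iff' measurableSet_Ioi).2 (ae_of_all _ hp)), i2]
    simp
  rw [← h2, ← lintegral_indicator measurableSet_Ioi, ← lintegral_indicator measurableSet_Ioi]
  have hne : ∀ᵐ r : ℝ, r ≠ t := by simp [ae_iff]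
  refine lintegral_congr_ae ?_
  filter_upwards [hne] with r hr
  by_cases h0 : 0 < r
  · rw [Set.indicator_of_mem (Set.mem_Ioi.2 h0)]
    by_cases h : t < r
    · have e : ∀ θ, circleMap 0 r θ ∈ {z : ℂ | t ≤ ‖z‖} := fun θ => by
        simp [abs_of_pos h0, h.le]
      simp only [Set.indicator_of_mem (e _), Set.indicator_of_mem (Set.mem_Ioi.2 h)]
      simp only [norm_circleMap_zero, sq_abs, Pi.one_apply, mul_one, lintegral_const,
        Measure.restrict_apply_univ, Real.volume_Ioo]
      rw [← ENNReal.ofReal_mul (by positivity), ← ENNReal.ofReal_mul (by positivity)]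
      congr 1
      field_simp
      ring
    · have e : ∀ θ, circleMap 0 r θ ∉ {z : ℂ | t ≤ ‖z‖} := fun θ => by
        have : r < t := lt_of_le_of_ne (not_lt.1 h) hr
        simp [abs_of_pos h0, this]
      simp [Set.indicator_of_notMem (e _), h]
  · have : ¬ t < r := by linarith [not_lt.1 h0]
    simp [h0, this]

/-- A standard complex Gaussian is as random as a whole sequence of them: `exp (-|g|²)` is uniform
on `[0, 1]`, and a uniform variable can be mapped to any law on a standard Borel space. -/
theorem exists_measurable_map_std_eq_infinitePi :
    ∃ ψ : ℂ → ℕ → ℂ, Measurable ψ ∧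
      stdComplexGaussian.map ψ = Measure.infinitePi fun _ => stdComplexGaussian := by
  obtain ⟨f, hf, hmap⟩ := Measure.exists_measurable_map_eq
    (Measure.infinitePi fun _ : ℕ => stdComplexGaussian)
  let u : ℂ → unitInterval := fun z =>
    ⟨Real.exp (-‖z‖ ^ 2), (Real.exp_pos _).le, Real.exp_le_one_iff.2 (by simp)⟩
  have hu : Measurable u := Measurable.subtype_mk (by fun_prop)
  have huv : stdComplexGaussian.map u = volume := by
    have : IsProbabilityMeasure (stdComplexGaussian.map u) :=
      Measure.isProbabilityMeasure_map hu.aemeasurable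
    refine Measure.ext_of_Iic _ _ fun x => ?_
    rw [Measure.map_apply hu measurableSet_Iic, unitInterval.volume_Iic]
    rcases eq_or_lt_of_le x.2.1 with h0 | h0
    · have : u ⁻¹' Set.Iic x = ∅ := by
        ext z
        simp only [Set.mem_preimage, Set.mem_Iic, Set.mem_empty_iff_false, iff_false, not_le,
          ← Subtype.coe_lt_coe, ← h0, u]
        exact Real.exp_pos _
      rw [this, ← h0]; simp
    · have hlog : 0 ≤ -Real.log x := by
        have := Real.log_nonpos x.2.1 x.2.2
        linarith
      have : u ⁻¹' Set.Iic x = {z | Real.sqrt (-Real.log x) ≤ ‖z‖} := by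
        ext z
        simp only [Set.mem_preimage, Set.mem_Iic, ← Subtype.coe_le_coe, u, Set.mem_ofPred_eq]
        rw [Real.sqrt_le_left (norm_nonneg _), ← Real.le_log_iff_exp_le h0]
        constructor <;> intro h <;> linarith
      rw [this, std_tail (Real.sqrt_nonneg _), Real.sq_sqrt hlog, neg_neg, Real.exp_log h0]
  exact ⟨f ∘ u, hf.comp hu, by rw [← Measure.map_map hf hu, huv, hmap]⟩

/-! ### Complex isonormal processes -/

section Isonormal

variable {Ω : Type*} [MeasurableSpace Ω] {μ : Measure Ω}
variable {E : Type*} [NormedAddCommGroup E] [InnerProductSpace ℂ E]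

theorem exists_linearIsometry_of_orthonormal {ι H : Type*} [NormedAddCommGroup H]
    [InnerProductSpace ℂ H] [CompleteSpace E]
    (b : HilbertBasis ι ℂ H) {v : ι → E} (hv : Orthonormal ℂ v) :
    ∃ T : H →ₗᵢ[ℂ] E, ∀ i, T (b i) = v i := by
  classical
  refine ⟨hv.orthogonalFamily.linearIsometry.comp b.repr.toLinearIsometry, fun i => ?_⟩
  simp [HilbertBasis.repr_self]

theorem Orthonormal.countable_index [SecondCountableTopology E] {ι : Type*} {v : ι → E}
    (hv : Orthonormal ℂ v) : Countable ι := by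
  refine Pairwise.countable_of_isOpen_disjoint (s := fun i => Metric.ball (v i) (1 / 2))
    (fun i j hij => Metric.ball_disjoint_ball ?_) (fun i => Metric.isOpen_ball)
    (fun i => ⟨v i, Metric.mem_ball_self (by norm_num)⟩)
  have h : ‖v i - v j‖ ^ 2 = 2 := by
    rw [@norm_sub_sq ℂ, hv.1 i, hv.1 j, hv.2 hij]
    norm_num
  rw [dist_eq_norm]
  nlinarith [norm_nonneg (v i - v j)]

/-- The norm-preserving linear map `X` from a Hilbert space into `L²(μ)` is a complex isonormal
process: each `X v` is a centred complex Gaussian of variance `‖v‖²`. Since `X` is complex linear,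
this is the statement that `Re (X v)` has the characteristic function of a centred real Gaussian
of variance `‖v‖² / 2`. -/
def IsIsonormal (X : E →ₗᵢ[ℂ] Lp ℂ 2 μ) : Prop :=
  ∀ v, ∫ ω, Complex.exp (((X v ω).re : ℝ) * Complex.I) ∂μ =
    Complex.exp (-((‖v‖ ^ 2 / 4 : ℝ) : ℂ))

theorem charFun_map_one (Y : Ω → ℂ) (hY : AEMeasurable Y μ) :
    charFun (μ.map Y) 1 = ∫ ω, Complex.exp (((Y ω).re : ℝ) * Complex.I) ∂μ := by
  rw [charFun_apply, integral_map hY]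
  · simp
  · fun_prop

theorem charFun_map_mul (Y : Ω → ℂ) (hY : AEMeasurable Y μ) (c : ℂ) :
    charFun (μ.map fun ω => c * Y ω) 1 = charFun (μ.map Y) (starRingEnd ℂ c) := by
  rw [charFun_apply, charFun_apply, integral_map hY (by fun_prop),
    integral_map (hY.const_mul c) (by fun_prop)]
  simp

theorem memLp_two_of_std {g : Ω → ℂ} (hm : Measurable g) (h : μ.map g = stdComplexGaussian) :
    MemLp g 2 μ := by
  refine ⟨hm.aestronglyMeasurable, ?_⟩
  rw [eLpNorm_lt_top_iff_lintegral_rpow_enorm_lt_top (by simp) (by simp)]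
  have := lintegral_enorm_pow_std 1
  rw [← h, lintegral_map (by fun_prop) hm] at this
  simp at this
  simp [this]

theorem integral_eq_zero_of_std {g : Ω → ℂ} (hm : Measurable g)
    (h : μ.map g = stdComplexGaussian) : ∫ ω, g ω ∂μ = 0 := by
  rw [← integral_id_std, ← h, integral_map hm.aemeasurable (by fun_prop)]

theorem eLpNorm_two_of_std {g : Ω → ℂ} (hm : Measurable g) (h : μ.map g = stdComplexGaussian) :
    eLpNorm g 2 μ = 1 := by
  rw [eLpNorm_eq_lintegral_rpow_enorm_toReal (by simp) (by simp)]
  have := lintegral_enorm_pow_std 1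
  rw [← h, lintegral_map (by fun_prop) hm] at this
  simp at this
  simp [this]

theorem orthonormal_toLp_of_std {I : Type*} {g : I → Ω → ℂ} (hm : ∀ i, Measurable (g i))
    (hlaw : ∀ i, μ.map (g i) = stdComplexGaussian) (hind : iIndepFun g μ) :
    Orthonormal ℂ fun i => (memLp_two_of_std (hm i) (hlaw i)).toLp := by
  constructor
  · intro i
    rw [Lp.norm_toLp, eLpNorm_two_of_std (hm i) (hlaw i)]
    simp
  · intro i j hij
    have h1 : IndepFun (fun ω => starRingEnd ℂ (g i ω)) (g j) μ :=
      (hind.indepFun hij).comp (φ := starRingEnd ℂ) (ψ := id) (by fun_prop) measurable_id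
    rw [L2.inner_def]
    have : ∫ ω, inner ℂ ((memLp_two_of_std (hm i) (hlaw i)).toLp (g i) ω)
        ((memLp_two_of_std (hm j) (hlaw j)).toLp (g j) ω) ∂μ
        = ∫ ω, starRingEnd ℂ (g i ω) * g j ω ∂μ := by
      refine integral_congr_ae ?_
      filter_upwards [(memLp_two_of_std (hm i) (hlaw i)).coeFn_toLp,
        (memLp_two_of_std (hm j) (hlaw j)).coeFn_toLp] with ω h h'
      rw [h, h', RCLike.inner_apply']
    rw [this, h1.integral_fun_mul_eq_mul_integral
      (by have := hm i; fun_prop) (hm j).aestronglyMeasurable,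
      integral_eq_zero_of_std (hm j) (hlaw j), mul_zero]

theorem IsIsonormal.charFun_map {X : E →ₗᵢ[ℂ] Lp ℂ 2 μ} (hX : IsIsonormal X) (v : E) (t : ℂ) :
    charFun (μ.map (X v)) t = Complex.exp (-((‖t‖ ^ 2 * ‖v‖ ^ 2 / 4 : ℝ) : ℂ)) := by
  have hv := (Lp.aestronglyMeasurable (X v)).aemeasurable
  have h := hX (starRingEnd ℂ t • v)
  rw [norm_smul, RCLike.norm_conj, mul_pow] at h
  rw [← h, ← Complex.conj_conj t, ← charFun_map_mul _ hv, charFun_map_one _ (by fun_prop),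
    Complex.conj_conj]
  refine integral_congr_ae ?_
  rw [map_smul]
  filter_upwards [Lp.coeFn_smul (starRingEnd ℂ t) (X v)] with ω h
  rw [h]; simp

theorem norm_exp_I_sub_le (x y : ℝ) :
    ‖Complex.exp (x * Complex.I) - Complex.exp (y * Complex.I)‖ ≤ |x - y| := by
  have h : Complex.exp (x * Complex.I) - Complex.exp (y * Complex.I) =
      Complex.exp (y * Complex.I) * (Complex.exp (Complex.I * ((x - y : ℝ) : ℂ)) - 1) := by
    rw [mul_sub, mul_one, ← Complex.exp_add]
    congr 2; push_cast; ring
  rw [h, norm_mul, Complex.norm_exp_ofReal_mul_I, one_mul]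
  exact Real.norm_exp_I_mul_ofReal_sub_one_le

variable [IsProbabilityMeasure μ]

theorem integrable_exp_re (f : Lp ℂ 2 μ) :
    Integrable (fun ω => Complex.exp (((f ω).re : ℝ) * Complex.I)) μ := by
  have hf := (Lp.aestronglyMeasurable f).aemeasurable
  refine Integrable.of_bound (C := 1) (by fun_prop) (ae_of_all _ fun ω => ?_)
  rw [Complex.norm_exp_ofReal_mul_I]

theorem continuous_integral_exp_re :
    Continuous fun f : Lp ℂ 2 μ => ∫ ω, Complex.exp (((f ω).re : ℝ) * Complex.I) ∂μ := by
  refine LipschitzWith.continuous (K := 1) (LipschitzWith.of_dist_le_mul fun f g => ?_)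
  rw [dist_eq_norm, NNReal.coe_one, one_mul, dist_eq_norm,
    ← integral_sub (integrable_exp_re f) (integrable_exp_re g)]
  have hfg : MemLp (f - g : Lp ℂ 2 μ) 1 μ := (Lp.memLp (f - g)).mono_exponent (by norm_num)
  calc _ ≤ ∫ ω, ‖(f - g : Lp ℂ 2 μ) ω‖ ∂μ := by
        refine norm_integral_le_of_norm_le (memLp_one_iff_integrable.1 hfg).norm ?_
        filter_upwards [Lp.coeFn_sub f g] with ω h
        refine (norm_exp_I_sub_le _ _).trans ?_
        rw [h, Pi.sub_apply, ← Complex.sub_re]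
        exact Complex.abs_re_le_norm _
    _ = (eLpNorm (f - g : Lp ℂ 2 μ) 1 μ).toReal := by
        rw [eLpNorm_one_eq_lintegral_enorm, integral_norm_eq_lintegral_enorm hfg.1]
    _ ≤ ‖f - g‖ := by
        rw [Lp.norm_def]
        exact ENNReal.toReal_mono (Lp.memLp (f - g)).2.ne
          (eLpNorm_le_eLpNorm_of_exponent_le (by norm_num) hfg.1)

/-- A Hilbert basis and independent standard complex Gaussians indexed by it determine an
isonormal process. -/
theorem exists_isonormal {I : Type*} (b : HilbertBasis I ℂ E) {g : I → Ω → ℂ}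
    (hm : ∀ i, Measurable (g i)) (hlaw : ∀ i, μ.map (g i) = stdComplexGaussian)
    (hind : iIndepFun g μ) :
    ∃ X : E →ₗᵢ[ℂ] Lp ℂ 2 μ, IsIsonormal X ∧ ∀ i, X (b i) =ᵐ[μ] g i := by
  obtain ⟨X, hX⟩ := exists_linearIsometry_of_orthonormal b (orthonormal_toLp_of_std hm hlaw hind)
  have hXb : ∀ i, X (b i) =ᵐ[μ] g i := fun i => by
    rw [hX]; exact (memLp_two_of_std (hm i) (hlaw i)).coeFn_toLp
  refine ⟨X, fun v => ?_, hXb⟩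
  have hcl : IsClosed {v : E | ∫ ω, Complex.exp (((X v ω).re : ℝ) * Complex.I) ∂μ =
      Complex.exp (-((‖v‖ ^ 2 / 4 : ℝ) : ℂ))} :=
    isClosed_eq (continuous_integral_exp_re.comp X.continuous) (by fun_prop)
  have hd : v ∈ closure (Submodule.span ℂ (Set.range b) : Set E) := by
    have := b.dense_span
    rw [← Submodule.topologicalClosure_coe, this]; trivial
  refine hcl.closure_subset_iff.2 ?_ hd
  intro v hv
  obtain ⟨c, rfl⟩ := Finsupp.mem_span_range_iff_exists_finsupp.1 hv
  have hXv : X (c.sum fun i a => a • b i) =ᵐ[μ] fun ω => ∑ i ∈ c.support, c i * g i ω := by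
    have e : X (c.sum fun i a => a • b i) = ∑ i ∈ c.support, c i • X (b i) := by
      simp [Finsupp.sum]
    rw [e]
    have h1 : ∀ᵐ ω ∂μ, ∀ i ∈ c.support, (c i • X (b i) : Lp ℂ 2 μ) ω = c i * g i ω := by
      refine (ae_ball_iff (Finset.countable_toSet c.support)).2 fun i _ => ?_
      filter_upwards [Lp.coeFn_smul (c i) (X (b i)), hXb i] with ω h h'
      rw [h, Pi.smul_apply, h', smul_eq_mul]
    filter_upwards [Lp.coeFn_finsetSum c.support fun i => c i • X (b i), h1] with ω h h'
    rw [h, Finset.sum_apply]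
    exact Finset.sum_congr rfl h'
  have hnorm : ‖c.sum fun i a => a • b i‖ ^ 2 = ∑ i ∈ c.support, ‖c i‖ ^ 2 := by
    have := b.orthonormal.inner_sum c c c.support
    rw [inner_self_eq_norm_sq_to_K] at this
    have h2 : ∑ i ∈ c.support, starRingEnd ℂ (c i) * c i =
      ((∑ i ∈ c.support, ‖c i‖ ^ 2 : ℝ) : ℂ) := by
      push_cast
      exact Finset.sum_congr rfl fun i _ => by rw [Complex.conj_mul']
    rw [h2] at this
    refine Complex.ofReal_injective (Eq.trans ?_ this)
    simp [Finsupp.sum]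
  have hmc : ∀ i, Measurable fun ω => c i * g i ω := fun i => (hm i).const_mul _
  have hindc : iIndepFun (fun i ω => c i * g i ω) μ :=
    hind.comp (fun i z => c i * z) fun i => by fun_prop
  have hY : AEMeasurable (fun ω => ∑ i ∈ c.support, c i * g i ω) μ := by fun_prop
  have hint : ∫ ω, Complex.exp (((X (c.sum fun i a => a • b i) ω).re : ℝ) * Complex.I) ∂μ =
      ∫ ω, Complex.exp (((∑ i ∈ c.support, c i * g i ω).re : ℝ) * Complex.I) ∂μ :=
    integral_congr_ae (hXv.mono fun ω h => by simp only [h])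
  rw [Set.mem_ofPred_eq, hnorm, hint, ← charFun_map_one _ hY,
    (hindc.restrict c.support).charFun_map_fun_finsetSum_eq_prod fun i _ => (hmc i).aemeasurable,
    Finset.prod_apply]
  have : ∀ i ∈ c.support, charFun (μ.map fun ω => c i * g i ω) 1 =
      Complex.exp (-((‖c i‖ ^ 2 / 4 : ℝ) : ℂ)) := fun i _ => by
    rw [charFun_map_mul _ (hm i).aemeasurable, hlaw, charFun_std, RCLike.norm_conj]
  rw [Finset.prod_congr rfl this, ← Complex.exp_sum]
  congr 1
  push_cast
  rw [Finset.sum_neg_distrib, Finset.sum_div]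

theorem IsIsonormal.map_eq_std {X : E →ₗᵢ[ℂ] Lp ℂ 2 μ} (hX : IsIsonormal X) {v : E}
    (hv : ‖v‖ = 1) : μ.map (X v) = stdComplexGaussian := by
  have : IsProbabilityMeasure (μ.map (X v)) :=
    Measure.isProbabilityMeasure_map (Lp.aestronglyMeasurable (X v)).aemeasurable
  refine Measure.ext_of_charFun ?_
  ext t
  rw [hX.charFun_map, charFun_std, hv]
  simp

/-- The image of an orthonormal family under an isonormal process is an independent family. -/
theorem IsIsonormal.iIndepFun_of_orthonormal {X : E →ₗᵢ[ℂ] Lp ℂ 2 μ} (hX : IsIsonormal X) {I : Type*}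
    {v : I → E} (hv : Orthonormal ℂ v) : iIndepFun (fun i => (X (v i) : Ω → ℂ)) μ := by
  rw [iIndepFun_iff_finset]
  intro s
  have hm : ∀ i, AEMeasurable (X (v i)) μ := fun i =>
    (Lp.aestronglyMeasurable (X (v i))).aemeasurable
  refine (iIndepFun_iff_charFun_pi (X := s.restrict fun i => (X (v i) : Ω → ℂ))
    fun i => hm i).2 ?_
  intro t
  have hmt : AEMeasurable (fun ω => WithLp.toLp 2 fun i : s => X (v i) ω) μ :=
    (PiLp.continuous_toLp 2 _).measurable.comp_aemeasurable (aemeasurable_pi_iff.2 fun i => hm i)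
  have h1 : charFun (μ.map fun ω => WithLp.toLp 2 fun i : s => X (v i) ω) t =
      ∫ ω, Complex.exp (((X (∑ i : s, starRingEnd ℂ (t i) • v i) ω).re : ℝ) * Complex.I) ∂μ := by
    rw [charFun_apply, integral_map hmt (by fun_prop)]
    refine integral_congr_ae ?_
    have e : X (∑ i : s, starRingEnd ℂ (t i) • v i) =
        ∑ i : s, starRingEnd ℂ (t i) • X (v i) := by simp
    rw [e]
    have h2 : ∀ᵐ ω ∂μ, ∀ i : s, (starRingEnd ℂ (t i) • X (v i) : Lp ℂ 2 μ) ω =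
        starRingEnd ℂ (t i) * X (v i) ω := by
      rw [ae_all_iff]
      intro i
      filter_upwards [Lp.coeFn_smul (starRingEnd ℂ (t i)) (X (v i))] with ω h
      rw [h]; simp
    filter_upwards [Lp.coeFn_finsetSum Finset.univ fun i : s => starRingEnd ℂ (t i) • X (v i),
      h2] with ω h h'
    rw [h, Finset.sum_apply, Finset.sum_congr rfl fun i _ => h' i, Complex.re_sum,
      PiLp.inner_apply]
    congr 3
    refine Finset.sum_congr rfl fun i _ => ?_
    rw [Complex.inner]; simp
  have hnorm : ‖∑ i : s, starRingEnd ℂ (t i) • v i‖ ^ 2 = ∑ i : s, ‖t i‖ ^ 2 := by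
    have := (hv.comp (Subtype.val : s → I) Subtype.val_injective).inner_sum
      (fun i => starRingEnd ℂ (t i)) (fun i => starRingEnd ℂ (t i)) Finset.univ
    simp only [Function.comp_apply] at this
    rw [inner_self_eq_norm_sq_to_K] at this
    have h2 : ∑ i : s, starRingEnd ℂ (starRingEnd ℂ (t i)) * starRingEnd ℂ (t i) =
      ((∑ i : s, ‖t i‖ ^ 2 : ℝ) : ℂ) := by
      push_cast
      exact Finset.sum_congr rfl fun i _ => by rw [Complex.conj_conj, Complex.mul_conj']
    rw [h2] at this
    refine Complex.ofReal_injective (Eq.trans ?_ this)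
    simp
  refine h1.trans ?_
  rw [hX, hnorm]
  have : ∀ i : s, charFun (μ.map (s.restrict (fun i => (X (v i) : Ω → ℂ)) i)) (t i) =
      Complex.exp (-((‖t i‖ ^ 2 / 4 : ℝ) : ℂ)) := fun i => by
    rw [Finset.restrict, hX.charFun_map, hv.1, one_pow, mul_one]
  rw [Finset.prod_congr rfl fun i _ => this i, ← Complex.exp_sum]
  congr 1
  push_cast
  rw [Finset.sum_neg_distrib, Finset.sum_div]

/-- The even absolute moments of a complex Gaussian of variance `‖v‖²`. -/
theorem IsIsonormal.lintegral_enorm_pow {X : E →ₗᵢ[ℂ] Lp ℂ 2 μ} (hX : IsIsonormal X) (v : E)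
    {k : ℕ} (hk : k ≠ 0) :
    ∫⁻ ω, ‖X v ω‖ₑ ^ (2 * k) ∂μ = ‖v‖ₑ ^ (2 * k) * (k.factorial : ℝ≥0∞) := by
  rcases eq_or_ne v 0 with rfl | hv
  · rw [map_zero]
    have : ∀ᵐ ω ∂μ, ‖(0 : Lp ℂ 2 μ) ω‖ₑ ^ (2 * k) = 0 := by
      filter_upwards [Lp.coeFn_zero ℂ 2 μ] with ω h
      rw [h]; simp [hk]
    rw [lintegral_congr_ae this]
    simp [hk]
  have hn : (‖v‖ : ℂ) ≠ 0 := by simpa using hv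
  set u : E := (‖v‖ : ℂ)⁻¹ • v with hu
  have hu1 : ‖u‖ = 1 := by simp [hu, norm_smul, hv]
  have hvu : v = (‖v‖ : ℂ) • u := by rw [hu, smul_smul, mul_inv_cancel₀ hn, one_smul]
  have hXv : ∀ᵐ ω ∂μ, ‖X v ω‖ₑ ^ (2 * k) = ‖v‖ₑ ^ (2 * k) * ‖X u ω‖ₑ ^ (2 * k) := by
    have : X v = (‖v‖ : ℂ) • X u := by rw [← map_smul, ← hvu]
    rw [this]
    filter_upwards [Lp.coeFn_smul (‖v‖ : ℂ) (X u)] with ω h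
    rw [h, Pi.smul_apply, enorm_smul, mul_pow]
    congr 2
    rw [← ofReal_norm, ← ofReal_norm]; simp
  rw [lintegral_congr_ae hXv, lintegral_const_mul' _ _ (by simp), ← lintegral_enorm_pow_std,
    ← hX.map_eq_std hu1, lintegral_map' (by fun_prop)
      (Lp.aestronglyMeasurable (X u)).aemeasurable]

end Isonormal

/-! ### Making room for new randomness -/

section Extension

variable {Ω : Type*} [MeasurableSpace Ω] {μ : Measure Ω} [IsProbabilityMeasure μ]

/-- Room for additional randomness inside a given probability space. An isonormal process `X` on
`H` differs from the restriction along `V : H → E` of an isonormal process `X'` on the larger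
space `E` only in the direction of a prescribed unit vector `c`.

The Gaussian `X c` is replaced by the first member of a sequence of independent Gaussians which is
a function of `X c`; the other members serve the directions of `E` orthogonal to `V H`. -/
theorem IsIsonormal.exists_extension {H E : Type*} [NormedAddCommGroup H] [InnerProductSpace ℂ H]
    [CompleteSpace H] [NormedAddCommGroup E] [InnerProductSpace ℂ E] [CompleteSpace E]
    [SecondCountableTopology E] {X : H →ₗᵢ[ℂ] Lp ℂ 2 μ} (hX : IsIsonormal X)
    (V : H →ₗᵢ[ℂ] E) {c : H} (hc : ‖c‖ = 1) :
    ∃ X' : E →ₗᵢ[ℂ] Lp ℂ 2 μ, IsIsonormal X' ∧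
      ∀ h, X h - X' (V h) = inner ℂ c h • (X c - X' (V c)) := by
  classical
  have hs : Orthonormal ℂ ((↑) : ({c} : Set H) → H) := by
    refine ⟨fun i => ?_, fun i j hij => (hij (Subsingleton.elim _ _)).elim⟩
    rw [Set.mem_singleton_iff.1 i.2, hc]
  obtain ⟨w, b, hcw, hb⟩ := hs.exists_hilbertBasis_extension
  have hbi : ∀ i, b i = i := fun i => by rw [hb]
  let c₀ : w := ⟨c, hcw rfl⟩
  have hVb : Orthonormal ℂ (fun i => V (b i)) := b.orthonormal.comp_linearIsometry V
  obtain ⟨w', b', hw', hb'⟩ := hVb.toSubtypeRange.exists_hilbertBasis_extension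
  have : Countable w' := b'.orthonormal.countable_index
  obtain ⟨enc, henc⟩ := exists_injective_nat w'
  obtain ⟨ψ, hψ, hψmap⟩ := exists_measurable_map_std_eq_infinitePi
  have hY : ∀ i, Measurable (X (b i) : Ω → ℂ) := fun i => (Lp.stronglyMeasurable _).measurable
  have hYlaw : ∀ i, μ.map (X (b i)) = stdComplexGaussian := fun i =>
    hX.map_eq_std (b.orthonormal.1 i)
  have hYind : iIndepFun (fun i => (X (b i) : Ω → ℂ)) μ := hX.iIndepFun_of_orthonormal b.orthonormal
  -- The Gaussian with index `c` is split into a sequence, the others are kept as they are.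
  let κ : w → Type := fun i => {m : ℕ // i = c₀ ∨ m = 0}
  let Φ : (i : w) → ℂ → κ i → ℂ := fun i z m => if i = c₀ then ψ z m.1 else z
  have hΦ : ∀ i m, Measurable fun z => Φ i z m := fun i m => by
    by_cases hi : i = c₀
    · simp only [Φ, hi, if_true]
      exact (measurable_pi_apply m.1).comp hψ
    · simp only [Φ, hi, if_false]
      exact measurable_id
  have hψind : iIndepFun (fun m ω => ψ (X (b c₀) ω) m) μ := by
    rw [iIndepFun_iff_hasLaw_Pi_infinitePi (μ := fun _ => stdComplexGaussian)]
    · refine ⟨(hψ.comp (hY c₀)).aemeasurable, ?_⟩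
      rw [← hψmap, ← hYlaw c₀, Measure.map_map hψ (hY c₀)]
      rfl
    · intro m
      refine ⟨((measurable_pi_apply m).comp (hψ.comp (hY c₀))).aemeasurable, ?_⟩
      have := Measure.map_map (μ := μ) (measurable_pi_apply m) (hψ.comp (hY c₀))
      rw [← Measure.map_map hψ (hY c₀), hYlaw, hψmap, Measure.infinitePi_map_eval] at this
      exact this.symm
    · exact (hψ.comp (hY c₀)).aemeasurable
  have hψlaw : ∀ m, μ.map (fun ω => ψ (X (b c₀) ω) m) = stdComplexGaussian := fun m => by
    have := Measure.map_map (μ := μ) (measurable_pi_apply m) (hψ.comp (hY c₀))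
    rw [← Measure.map_map hψ (hY c₀), hYlaw, hψmap, Measure.infinitePi_map_eval] at this
    exact this.symm
  have hZm : ∀ i m, Measurable fun ω => Φ i (X (b i) ω) m := fun i m => (hΦ i m).comp (hY i)
  have hZind : iIndepFun (fun (p : (i : w) × κ i) ω => Φ p.1 (X (b p.1) ω) p.2) μ := by
    refine iIndepFun_uncurry (X := fun i m ω => Φ i (X (b i) ω) m) hZm ?_ fun i => ?_
    · exact hYind.comp Φ fun i => measurable_pi_iff.2 (hΦ i)
    · by_cases hi : i = c₀
      · subst hi
        have := hψind.precomp (g := fun m : κ c₀ => m.1) Subtype.val_injective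
        simpa only [Φ, if_true] using this
      · have : Subsingleton (κ i) :=
          ⟨fun m m' => Subtype.ext ((m.2.resolve_left hi).trans (m'.2.resolve_left hi).symm)⟩
        exact iIndepFun.of_subsingleton
  have hZlaw : ∀ i m, μ.map (fun ω => Φ i (X (b i) ω) m) = stdComplexGaussian := fun i m => by
    by_cases hi : i = c₀
    · subst hi; simpa only [Φ, if_true] using hψlaw m.1
    · simpa only [Φ, hi, if_false] using hYlaw i
  let φ : w' → (i : w) × κ i := fun e =>
    if h : ∃ i, V (b i) = e then ⟨h.choose, 0, Or.inr rfl⟩ else ⟨c₀, enc e + 1, Or.inl rfl⟩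
  have hφinj : Function.Injective φ := by
    intro e e' hee
    simp only [φ] at hee
    split_ifs at hee with h h' h'
    · have h1 : h.choose = h'.choose := (Sigma.mk.inj_iff.1 hee).1
      have h2 := h.choose_spec
      rw [h1, h'.choose_spec] at h2
      exact Subtype.ext h2.symm
    · obtain ⟨h1, h2⟩ := Sigma.mk.inj_iff.1 hee
      rw [h1] at h2
      exact absurd (congrArg Subtype.val (eq_of_heq h2)) (Nat.succ_ne_zero _).symm
    · obtain ⟨h1, h2⟩ := Sigma.mk.inj_iff.1 hee
      rw [← h1] at h2
      exact absurd (congrArg Subtype.val (eq_of_heq h2)) (Nat.succ_ne_zero _)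
    · have h2 := congrArg Subtype.val (eq_of_heq (Sigma.mk.inj_iff.1 hee).2)
      exact henc (Nat.succ_injective h2)
  have hφ : ∀ i, φ ⟨V (b i), hw' ⟨i, rfl⟩⟩ = ⟨i, 0, Or.inr rfl⟩ := fun i => by
    have h : ∃ k, V (b k) = V (b i) := ⟨i, rfl⟩
    have hmk : ∀ k, k = i → (⟨k, 0, Or.inr rfl⟩ : (i : w) × κ i) = ⟨i, 0, Or.inr rfl⟩ := by
      rintro k rfl; rfl
    simp only [φ]
    rw [dif_pos h]
    exact hmk _ (hVb.linearIndependent.injective h.choose_spec)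
  obtain ⟨X', hX', hX'b⟩ := exists_isonormal b' (fun e => hZm (φ e).1 (φ e).2)
    (fun e => hZlaw _ _) (hZind.precomp hφinj)
  refine ⟨X', hX', ?_⟩
  have hXX' : ∀ i, i ≠ c₀ → X (b i) = X' (V (b i)) := fun i hi => by
    have h1 := hX'b ⟨V (b i), hw' ⟨i, rfl⟩⟩
    rw [hφ i, hb'] at h1
    refine Lp.ext (h1.trans ?_).symm
    simp only [Φ, hi, if_false]
    rfl
  let T : H →L[ℂ] Lp ℂ 2 μ := X.toContinuousLinearMap - (X'.comp V).toContinuousLinearMap -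
    (innerSL ℂ c).smulRight (X c - X' (V c))
  have hT : ∀ h, T h = X h - X' (V h) - inner ℂ c h • (X c - X' (V c)) := fun h => by
    simp [T]
  have hT0 : T = 0 := by
    refine ContinuousLinearMap.ext_on (s := Set.range b) ?_ ?_
    · have := b.dense_span
      rw [← Submodule.dense_iff_topologicalClosure_eq_top] at this
      exact this
    · rintro _ ⟨i, rfl⟩
      rw [hT]
      have hcc : b c₀ = c := hbi c₀
      by_cases hi : i = c₀
      · rw [hi, hcc, inner_self_eq_norm_sq_to_K, hc]
        simp
      · have h0 : inner ℂ (b c₀) (b i) = 0 := b.orthonormal.2 (Ne.symm hi)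
        rw [hcc] at h0
        simp [hXX' i hi, h0]
  intro h
  have := hT h
  rw [hT0] at this
  exact (sub_eq_zero.1 this.symm)

end Extension

/-! ### Lifting functions to graphs -/

/-- The `L²` sum of a series agrees almost everywhere with its pointwise sum. -/
theorem ae_eq_of_hasSum_Lp {α : Type*} [MeasurableSpace α] {ν : Measure α}
    {f : ℕ → Lp ℂ 2 ν} {g : Lp ℂ 2 ν} (hf : HasSum f g) {h : α → ℂ}
    (hh : ∀ᵐ x ∂ν, HasSum (fun n => f n x) (h x)) : g =ᵐ[ν] h := by
  obtain ⟨ns, hns, hlim⟩ :=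
    (tendstoInMeasure_of_tendsto_Lp hf.tendsto_sum_nat).exists_seq_tendsto_ae
  have h1 : ∀ᵐ x ∂ν, ∀ N, (∑ n ∈ Finset.range N, f n : Lp ℂ 2 ν) x =
      ∑ n ∈ Finset.range N, f n x := by
    rw [ae_all_iff]
    intro N
    filter_upwards [Lp.coeFn_finsetSum (Finset.range N) f] with x hx
    rw [hx, Finset.sum_apply]
  filter_upwards [hlim, h1, hh] with x hx h1 hh
  simp only [h1] at hx
  exact tendsto_nhds_unique hx (hh.tendsto_sum_nat.comp hns.tendsto_atTop)

section Graph

variable {α : Type*} [MeasurableSpace α]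

/-- The graph of `σ : α → ℕ`. -/
def graphSet {α : Type*} (σ : α → ℕ) : Set (α × ℕ) := {p | p.2 = σ p.1}

theorem measurableSet_graph_nat {σ : α → ℕ} (hσ : Measurable σ) :
    MeasurableSet (graphSet σ) :=
  measurableSet_eq_fun measurable_snd (hσ.comp measurable_fst)

variable {ν : Measure α}

theorem measurePreserving_fst_graph {σ : α → ℕ} (hσ : Measurable σ) :
    MeasurePreserving Prod.fst
      ((ν.prod Measure.count).restrict (graphSet σ)) ν := by
  refine ⟨measurable_fst, Measure.ext fun A hA => ?_⟩
  rw [Measure.map_apply measurable_fst hA, Measure.restrict_apply (measurable_fst hA),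
    Measure.prod_apply ((measurable_fst hA).inter (measurableSet_graph_nat hσ)),
    ← lintegral_indicator_one hA]
  refine lintegral_congr fun x => ?_
  by_cases hx : x ∈ A
  · have : Prod.mk x ⁻¹' (Prod.fst ⁻¹' A ∩ graphSet σ) = {σ x} := by
      ext m; simp [hx, graphSet]
    rw [this]; simp [hx]
  · have : Prod.mk x ⁻¹' (Prod.fst ⁻¹' A ∩ graphSet σ) = ∅ := by
      ext m; simp [hx, graphSet]
    rw [this]; simp [hx]

theorem eLpNorm_graph {σ : α → ℕ} (hσ : Measurable σ) {f : α → ℂ}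
    (hf : AEStronglyMeasurable f ν) :
    eLpNorm ((graphSet σ).indicator (f ∘ Prod.fst)) 2 (ν.prod Measure.count) =
      eLpNorm f 2 ν := by
  rw [eLpNorm_indicator_eq_eLpNorm_restrict (measurableSet_graph_nat hσ),
    eLpNorm_comp_measurePreserving hf (measurePreserving_fst_graph hσ)]

theorem memLp_graph {σ : α → ℕ} (hσ : Measurable σ) {f : α → ℂ} (hf : MemLp f 2 ν) :
    MemLp ((graphSet σ).indicator (f ∘ Prod.fst)) 2 (ν.prod Measure.count) := by
  rw [memLp_indicator_iff_restrict (measurableSet_graph_nat hσ)]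
  exact hf.comp_measurePreserving (measurePreserving_fst_graph hσ)



/-- The isometric copy of `L²(ν)` inside `L²(ν × counting measure on ℕ)` formed by the functions
supported on the graph of `σ`. -/
noncomputable def graphLift (σ : α → ℕ) (hσ : Measurable σ) :
    Lp ℂ 2 ν →ₗᵢ[ℂ] Lp ℂ 2 (ν.prod (Measure.count : Measure ℕ)) where
  toFun f := (memLp_graph hσ (Lp.memLp f)).toLp
  map_add' f g := by
    rw [← MemLp.toLp_add]
    refine MemLp.toLp_congr _ _ ?_
    filter_upwards [Measure.quasiMeasurePreserving_fst.ae (Lp.coeFn_add f g)] with p hp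
    by_cases h : p ∈ graphSet σ
    · simp only [Set.indicator_of_mem h, Pi.add_apply, Function.comp_apply]
      exact hp
    · simp [h]
  map_smul' c f := by
    rw [RingHom.id_apply, ← MemLp.toLp_const_smul]
    refine MemLp.toLp_congr _ _ ?_
    filter_upwards [Measure.quasiMeasurePreserving_fst.ae (Lp.coeFn_smul c f)] with p hp
    by_cases h : p ∈ graphSet σ
    · simp only [Set.indicator_of_mem h, Pi.smul_apply, Function.comp_apply]
      exact hp
    · simp [h]
  norm_map' f := by
    change ‖(memLp_graph hσ (Lp.memLp f)).toLp‖ = ‖f‖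
    rw [Lp.norm_toLp, eLpNorm_graph hσ (Lp.aestronglyMeasurable f), Lp.norm_def]

theorem coeFn_graphLift {σ : α → ℕ} (hσ : Measurable σ) (f : Lp ℂ 2 ν) :
    graphLift σ hσ f =ᵐ[ν.prod Measure.count] (graphSet σ).indicator (f ∘ Prod.fst) :=
  (memLp_graph hσ (Lp.memLp f)).coeFn_toLp

theorem inner_graphLift_of_disjoint {σ τ : α → ℕ} (hσ : Measurable σ) (hτ : Measurable τ)
    (h : ∀ x, σ x ≠ τ x) (f g : Lp ℂ 2 ν) :
    inner ℂ (graphLift σ hσ f) (graphLift τ hτ g) = 0 := by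
  rw [L2.inner_def, integral_eq_zero_of_ae]
  filter_upwards [coeFn_graphLift hσ f, coeFn_graphLift hτ g] with p h1 h2
  rw [h1, h2]
  by_cases hp : p ∈ graphSet σ
  · have : p ∉ graphSet τ := fun hp' => h p.1 (hp.symm.trans hp')
    simp [this]
  · simp [hp]

/-- Two lifts of `f` are close if `f` is small where the graphs differ. -/
theorem norm_graphLift_sub_le {σ τ : α → ℕ} (hσ : Measurable σ) (hτ : Measurable τ)
    (f : Lp ℂ 2 ν) {δ : ℝ} (hδ : 0 ≤ δ)
    (h : eLpNorm ({x | σ x ≠ τ x}.indicator f) 2 ν ≤ ENNReal.ofReal δ) :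
    ‖graphLift σ hσ f - graphLift τ hτ f‖ ≤ 2 * δ := by
  have hA : MeasurableSet {x | σ x ≠ τ x} := (measurableSet_eq_fun hσ hτ).compl
  have hf : MemLp ({x | σ x ≠ τ x}.indicator f) 2 ν := (Lp.memLp f).indicator hA
  set F := hf.toLp with hF
  have e : graphLift σ hσ f - graphLift τ hτ f = graphLift σ hσ F - graphLift τ hτ F := by
    refine Lp.ext ?_
    filter_upwards [coeFn_graphLift hσ f, coeFn_graphLift hτ f, coeFn_graphLift hσ F,
      coeFn_graphLift hτ F, Lp.coeFn_sub (graphLift σ hσ f) (graphLift τ hτ f),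
      Lp.coeFn_sub (graphLift σ hσ F) (graphLift τ hτ F),
      Measure.quasiMeasurePreserving_fst.ae hf.coeFn_toLp] with p h1 h2 h3 h4 h5 h6 h7
    rw [h5, h6, Pi.sub_apply, Pi.sub_apply, h1, h2, h3, h4]
    by_cases hp : σ p.1 = τ p.1
    · have : p ∈ graphSet σ ↔ p ∈ graphSet τ := by simp [graphSet, hp]
      by_cases hq : p ∈ graphSet σ
      · simp [hq, this.1 hq]
      · simp [hq, mt this.2 hq]
    · have : F p.1 = f p.1 := by
        rw [h7]; exact Set.indicator_of_mem (by simpa using hp) _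
      have h8 : ∀ ρ : α → ℕ, (graphSet ρ).indicator (F ∘ Prod.fst) p =
          (graphSet ρ).indicator (f ∘ Prod.fst) p := fun ρ => by
        by_cases hq : p ∈ graphSet ρ
        · rw [Set.indicator_of_mem hq, Set.indicator_of_mem hq]
          exact this
        · rw [Set.indicator_of_notMem hq, Set.indicator_of_notMem hq]
      rw [h8, h8]
  have hFn : ‖F‖ ≤ δ := by
    rw [hF, Lp.norm_toLp]
    exact ENNReal.toReal_le_of_le_ofReal hδ h
  rw [e]
  refine (norm_sub_le _ _).trans ?_
  rw [LinearIsometry.norm_map, LinearIsometry.norm_map]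
  linarith

end Graph

/-! ### The Fock space and its Bargmann representation -/

section Fock

/-- The `n`-th Taylor monomial of a Gaussian entire function with the Gaussian weight:
`zⁿ / √n! · exp (-|z|² / 2)`. -/
noncomputable def fockMonomial (n : ℕ) (z : ℂ) : ℂ :=
  z ^ n / (Real.sqrt (n.factorial : ℝ) : ℂ) * (Real.exp (-(‖z‖ ^ 2) / 2) : ℂ)

theorem continuous_fockMonomial (n : ℕ) : Continuous (fockMonomial n) := by
  unfold fockMonomial; fun_prop

/-- The normalized reproducing kernel of the Bargmann–Fock space. -/
noncomputable def fockKernel (p z : ℂ) : ℂ :=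
  Complex.exp (starRingEnd ℂ p * z) * (Real.exp (-(‖p‖ ^ 2) / 2) * Real.exp (-(‖z‖ ^ 2) / 2) : ℝ)

theorem hasSum_fockKernel (p z : ℂ) :
    HasSum (fun n => starRingEnd ℂ (fockMonomial n p) * fockMonomial n z) (fockKernel p z) := by
  have h := NormedSpace.expSeries_div_hasSum_exp (starRingEnd ℂ p * z)
  rw [← Complex.exp_eq_exp_ℂ] at h
  convert! h.mul_right ((Real.exp (-(‖p‖ ^ 2) / 2) * Real.exp (-(‖z‖ ^ 2) / 2) : ℝ) : ℂ) using 1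
  funext n
  have h1 : ((Real.sqrt (n.factorial : ℝ) : ℂ)) * (Real.sqrt (n.factorial : ℝ) : ℂ) =
      (n.factorial : ℂ) := by
    rw [← Complex.ofReal_mul, Real.mul_self_sqrt (by positivity)]; simp
  rw [← h1]
  simp only [fockMonomial, map_mul, map_div₀, map_pow, Complex.conj_ofReal, Complex.ofReal_mul,
    mul_pow]
  ring

theorem norm_fockKernel (p z : ℂ) : ‖fockKernel p z‖ = Real.exp (-‖z - p‖ ^ 2 / 2) := by
  rw [fockKernel, norm_mul, Complex.norm_exp, Complex.norm_real, Real.norm_of_nonneg (by positivity),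
    ← Real.exp_add, ← Real.exp_add]
  congr 1
  rw [← Complex.normSq_eq_norm_sq, ← Complex.normSq_eq_norm_sq, ← Complex.normSq_eq_norm_sq,
    Complex.normSq_apply, Complex.normSq_apply, Complex.normSq_apply]
  simp
  ring

variable {H : Type*} [NormedAddCommGroup H] [InnerProductSpace ℂ H]

/-- The unit vector with coordinates `fockMonomial n z`: the value of the normalized Gaussian
entire function at `z` is the Gaussian attached to this vector. -/
theorem exists_fockVector (e : HilbertBasis ℕ ℂ H) (z : ℂ) :
    ∃ k : H, HasSum (fun n => fockMonomial n z • e n) k ∧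
      ∀ n, inner ℂ (e n) k = fockMonomial n z := by
  have hs : Memℓp (fun n => fockMonomial n z) 2 := by
    refine memℓp_gen ?_
    have := (hasSum_fockKernel z z).summable.norm
    refine this.congr fun n => ?_
    rw [Complex.conj_mul']
    simp
  refine ⟨e.repr.symm ⟨_, hs⟩, ?_, fun n => ?_⟩
  · exact e.hasSum_repr_symm ⟨_, hs⟩
  · rw [← e.repr_apply_apply]; simp

/-- A choice of the vector provided by `exists_fockVector`. -/
noncomputable def fockVector (e : HilbertBasis ℕ ℂ H) (z : ℂ) : H :=
  (exists_fockVector e z).choose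

theorem hasSum_fockVector (e : HilbertBasis ℕ ℂ H) (z : ℂ) :
    HasSum (fun n => fockMonomial n z • e n) (fockVector e z) :=
  (exists_fockVector e z).choose_spec.1

theorem inner_fockVector (e : HilbertBasis ℕ ℂ H) (z : ℂ) (n : ℕ) :
    inner ℂ (e n) (fockVector e z) = fockMonomial n z :=
  (exists_fockVector e z).choose_spec.2 n

theorem inner_fockVector_fockVector (e : HilbertBasis ℕ ℂ H) (p z : ℂ) :
    inner ℂ (fockVector e p) (fockVector e z) = fockKernel p z := by
  refine (e.hasSum_inner_mul_inner (fockVector e p) (fockVector e z)).unique ?_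
  convert! hasSum_fockKernel p z using 2 with n
  rw [inner_fockVector, ← inner_conj_symm, inner_fockVector]

theorem norm_fockVector (e : HilbertBasis ℕ ℂ H) (z : ℂ) : ‖fockVector e z‖ = 1 := by
  have h := inner_fockVector_fockVector e z z
  have h2 := congrArg norm h
  rw [norm_fockKernel, inner_self_eq_norm_sq_to_K] at h2
  simp only [sub_self, norm_zero] at h2
  norm_num at h2
  exact h2.resolve_right fun h => by linarith [norm_nonneg (fockVector e z)]

/-- The conjugated monomials, scaled to be orthonormal in `L²(ℂ)`. -/
noncomputable def fockDual (n : ℕ) (w : ℂ) : ℂ :=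
  starRingEnd ℂ (fockMonomial n w) * ((Real.sqrt Real.pi)⁻¹ : ℝ)

theorem continuous_fockDual (n : ℕ) : Continuous (fockDual n) := by
  have := continuous_fockMonomial n
  unfold fockDual; fun_prop

theorem eLpNorm_fockDual (n : ℕ) : eLpNorm (fockDual n) 2 volume = 1 := by
  have h := lintegral_enorm_pow_std n
  rw [lintegral_withDensity_std] at h
  have e : ∀ w : ℂ, ‖fockDual n w‖ₑ ^ (2 : ℝ) = (n.factorial : ℝ≥0∞)⁻¹ *
      (ENNReal.ofReal (Real.pi⁻¹ * Real.exp (-‖w‖ ^ 2)) * ‖w‖ₑ ^ (2 * n)) := by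
    intro w
    have hf : (n.factorial : ℝ≥0∞)⁻¹ = ENNReal.ofReal ((n.factorial : ℝ)⁻¹) := by
      rw [ENNReal.ofReal_inv_of_pos (by positivity), ENNReal.ofReal_natCast]
    rw [hf, ← ofReal_norm, ← ofReal_norm, ← ENNReal.ofReal_pow (norm_nonneg _),
      ← ENNReal.ofReal_mul (by positivity), ← ENNReal.ofReal_mul (by positivity),
      ENNReal.ofReal_rpow_of_nonneg (norm_nonneg _) (by norm_num)]
    congr 1
    have h1 := Real.sq_sqrt (Nat.cast_nonneg (α := ℝ) n.factorial)
    have h2 := Real.sq_sqrt Real.pi_pos.le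
    have h3 : Real.exp (-‖w‖ ^ 2 / 2) ^ 2 = Real.exp (-‖w‖ ^ 2) := by
      rw [← Real.exp_nat_mul]; congr 1; push_cast; ring
    simp only [fockDual, fockMonomial, norm_mul, RCLike.norm_conj, norm_div, norm_pow,
      Complex.norm_real, Real.norm_eq_abs, abs_of_nonneg (Real.sqrt_nonneg _), Real.abs_exp,
      abs_inv, Real.rpow_two, mul_pow, div_pow, h1, h3, inv_pow, h2]
    ring
  rw [eLpNorm_eq_lintegral_rpow_enorm_toReal (by simp) (by simp)]
  simp only [ENNReal.toReal_ofNat, e]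
  rw [lintegral_const_mul' _ _ (by simp [n.factorial_ne_zero]), h,
    ENNReal.inv_mul_cancel (by simp [n.factorial_ne_zero]) (by simp)]
  simp

theorem memLp_fockDual (n : ℕ) : MemLp (fockDual n) 2 volume :=
  ⟨(continuous_fockDual n).aestronglyMeasurable, by simp [eLpNorm_fockDual]⟩

theorem integral_conj_fockDual_mul {m n : ℕ} (h : m ≠ n) :
    ∫ w, starRingEnd ℂ (fockDual m w) * fockDual n w = 0 := by
  -- The rotation by `u = exp (iπ / (m - n))` multiplies the integrand by `-1`.
  have hmn : ((m : ℝ) - n) ≠ 0 := sub_ne_zero.2 (by exact_mod_cast h)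
  set u : Circle := Circle.exp (Real.pi / ((m : ℝ) - n)) with hu
  have hrot := (rotation u).measurePreserving.integral_comp'
    (f := (rotation u).toHomeomorph.toMeasurableEquiv)
    (g := fun w => starRingEnd ℂ (fockDual m w) * fockDual n w)
  have hun : (u : ℂ) ^ m * starRingEnd ℂ (u : ℂ) ^ n = -1 := by
    rw [hu, Circle.coe_exp, ← Complex.exp_conj, ← Complex.exp_nat_mul, ← Complex.exp_nat_mul,
      ← Complex.exp_add, ← Complex.exp_pi_mul_I]
    congr 1
    have : ((m : ℂ) - n) ≠ 0 := by exact_mod_cast hmn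
    simp only [map_mul, Complex.conj_ofReal, Complex.conj_I]
    push_cast
    field_simp
    ring
  have e : ∀ w, starRingEnd ℂ (fockDual m (rotation u w)) * fockDual n (rotation u w) =
      -(starRingEnd ℂ (fockDual m w) * fockDual n w) := by
    intro w
    have h1 : starRingEnd ℂ (fockDual m (rotation u w)) * fockDual n (rotation u w) =
      ((u : ℂ) ^ m * starRingEnd ℂ (u : ℂ) ^ n) *
        (starRingEnd ℂ (fockDual m w) * fockDual n w) := by
      simp only [fockDual, fockMonomial, rotation_apply, map_mul, map_div₀, map_pow,
        Complex.conj_conj, Complex.conj_ofReal, norm_mul, Circle.norm_coe, one_mul, mul_pow]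
      ring
    rw [h1, hun]; ring
  have h2 : ∫ w, starRingEnd ℂ (fockDual m (rotation u w)) * fockDual n (rotation u w) =
      ∫ w, starRingEnd ℂ (fockDual m w) * fockDual n w := hrot
  simp only [e, integral_neg] at h2
  exact self_eq_neg.1 h2.symm

theorem orthonormal_fockDual : Orthonormal ℂ fun n => (memLp_fockDual n).toLp := by
  constructor
  · intro n
    rw [Lp.norm_toLp, eLpNorm_fockDual]; simp
  · intro m n hmn
    rw [L2.inner_def, ← integral_conj_fockDual_mul hmn]
    refine integral_congr_ae ?_
    filter_upwards [(memLp_fockDual m).coeFn_toLp, (memLp_fockDual n).coeFn_toLp] with w h1 h2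
    rw [h1, h2, RCLike.inner_apply']

/-- The isometric embedding of the abstract Fock space into `L²(ℂ)`. It represents the vector
attached to `z` by a Gaussian bump centred at `z`. -/
theorem exists_bargmann (e : HilbertBasis ℕ ℂ H) :
    ∃ V : H →ₗᵢ[ℂ] Lp ℂ 2 (volume : Measure ℂ), ∀ z, V (fockVector e z) =ᵐ[volume]
      fun w => fockKernel w z * ((Real.sqrt Real.pi)⁻¹ : ℝ) := by
  obtain ⟨V, hV⟩ := exists_linearIsometry_of_orthonormal e orthonormal_fockDual
  refine ⟨V, fun z => ?_⟩
  have h : HasSum (fun n => fockMonomial n z • (memLp_fockDual n).toLp) (V (fockVector e z)) := by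
    have := (hasSum_fockVector e z).mapL V.toContinuousLinearMap
    simpa [hV] using this
  refine ae_eq_of_hasSum_Lp h ?_
  have h1 : ∀ᵐ w : ℂ, ∀ n, (fockMonomial n z • (memLp_fockDual n).toLp :
      Lp ℂ 2 (volume : Measure ℂ)) w = fockMonomial n z * fockDual n w := by
    rw [ae_all_iff]
    intro n
    filter_upwards [Lp.coeFn_smul (fockMonomial n z) (memLp_fockDual n).toLp,
      (memLp_fockDual n).coeFn_toLp] with w h h'
    rw [h, Pi.smul_apply, h', smul_eq_mul]
  filter_upwards [h1] with w hw
  simp only [hw]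
  refine ((hasSum_fockKernel w z).mul_right (((Real.sqrt Real.pi)⁻¹ : ℝ) : ℂ)).congr_fun ?_
  intro n
  simp only [fockDual]; ring

/-- A Gaussian bump has little mass away from its centre. -/
theorem eLpNorm_indicator_bargmann_le {f : ℂ → ℂ} {z : ℂ} {R : ℝ} (hR : 0 ≤ R)
    (hf : f =ᵐ[volume] fun w => fockKernel w z * ((Real.sqrt Real.pi)⁻¹ : ℝ)) {S : Set ℂ}
    (hS : ∀ w ∈ S, R ≤ ‖w - z‖) :
    eLpNorm (S.indicator f) 2 volume ≤ ENNReal.ofReal (Real.exp (-R ^ 2 / 2)) := by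
  rw [eLpNorm_eq_lintegral_rpow_enorm_toReal (by simp) (by simp)]
  have h1 : ∫⁻ w, ‖S.indicator f w‖ₑ ^ (2 : ℝ) ≤
      ∫⁻ w, ENNReal.ofReal (Real.pi⁻¹ * Real.exp (-‖w - z‖ ^ 2)) *
        {v : ℂ | R ≤ ‖v‖}.indicator 1 (w - z) := by
    refine lintegral_mono_ae ?_
    filter_upwards [hf] with w hw
    by_cases h : w ∈ S
    · have h' : w - z ∈ {v : ℂ | R ≤ ‖v‖} := hS w h
      rw [Set.indicator_of_mem h, Set.indicator_of_mem h', hw, Pi.one_apply, mul_one,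
        ← ofReal_norm, ENNReal.ofReal_rpow_of_nonneg (norm_nonneg _) (by norm_num)]
      refine ENNReal.ofReal_le_ofReal (le_of_eq ?_)
      rw [norm_mul, norm_fockKernel, Complex.norm_real, Real.norm_of_nonneg (by positivity),
        Real.rpow_two, mul_pow, inv_pow, Real.sq_sqrt Real.pi_pos.le, ← Real.exp_nat_mul,
        norm_sub_rev, mul_comm]
      congr 2
      push_cast; ring
    · simp [h]
  have h2 : ∫⁻ w, ENNReal.ofReal (Real.pi⁻¹ * Real.exp (-‖w - z‖ ^ 2)) *
      {v : ℂ | R ≤ ‖v‖}.indicator 1 (w - z) = ENNReal.ofReal (Real.exp (-R ^ 2)) := by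
    rw [lintegral_sub_right_eq_self (fun v : ℂ =>
      ENNReal.ofReal (Real.pi⁻¹ * Real.exp (-‖v‖ ^ 2)) * {v : ℂ | R ≤ ‖v‖}.indicator 1 v),
      ← lintegral_withDensity_std, lintegral_indicator_one
        (measurableSet_le measurable_const measurable_norm), std_tail hR]
  rw [h2] at h1
  refine (ENNReal.rpow_le_rpow h1 (by simp)).trans (le_of_eq ?_)
  rw [ENNReal.ofReal_rpow_of_nonneg (Real.exp_pos _).le (by simp), ← Real.exp_mul]
  congr 2
  simp; ring

end Fock

/-! ### Random entire functions with Gaussian coefficients -/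

/-- Disjoint subfamilies of a family of independent variables are independent. -/
theorem iIndepFun_curry {Ω ι κ : Type*} [MeasurableSpace Ω] {μ : Measure Ω}
    {Y : ι → κ → Ω → ℂ} (hY : ∀ i j, Measurable (Y i j))
    (h : iIndepFun (fun p : (_ : ι) × κ => Y p.1 p.2) μ) :
    iIndepFun (fun i ω j => Y i j ω) μ := by
  have := h.isProbabilityMeasure
  have hp : ∀ i j, IsProbabilityMeasure (μ.map (Y i j)) := fun i j =>
    Measure.isProbabilityMeasure_map (hY i j).aemeasurable
  rw [iIndepFun_iff_map_fun_eq_infinitePi_map (by fun_prop)]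
  have h1 := h.map_fun_eq_infinitePi_map fun p : (_ : ι) × κ => hY p.1 p.2
  have h2 : ∀ i, μ.map (fun ω j => Y i j ω) = Measure.infinitePi fun j => μ.map (Y i j) := fun i =>
    (h.precomp (g := fun j : κ => (⟨i, j⟩ : (_ : ι) × κ))
      (fun a b hab => eq_of_heq (Sigma.mk.inj_iff.1 hab).2)).map_fun_eq_infinitePi_map fun j => hY i j
  simp_rw [h2]
  rw [← Measure.infinitePi_map_piCurry fun i j => μ.map (Y i j), ← h1,
    Measure.map_map (by fun_prop) (by fun_prop)]
  rfl

section Series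

/-- The sequences `c` for which `∑ c n * zⁿ / √n!` converges absolutely in the whole plane. -/
def entireCoeffs : Set (ℕ → ℂ) :=
  {c | ∀ k : ℕ, ∑' n, ‖c n‖ₑ * ENNReal.ofReal ((k : ℝ) ^ n / Real.sqrt n.factorial) < ∞}

theorem measurableSet_entireCoeffs : MeasurableSet entireCoeffs := by
  rw [entireCoeffs, Set.ofPred_forall]
  refine MeasurableSet.iInter fun k => measurableSet_lt ?_ measurable_const
  fun_prop

open Classical in
/-- The entire function with coefficients `c n / √n!`, and `0` when the series fails to converge in
the whole plane; this convention makes the function measurable in `c`. -/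
noncomputable def entireSum (c : ℕ → ℂ) (z : ℂ) : ℂ :=
  if c ∈ entireCoeffs then ∑' n, c n * (z ^ n / (Real.sqrt (n.factorial : ℝ) : ℂ)) else 0

theorem summable_of_mem_entireCoeffs {c : ℕ → ℂ} (hc : c ∈ entireCoeffs) (k : ℕ) :
    Summable fun n => ‖c n‖ * ((k : ℝ) ^ n / Real.sqrt n.factorial) := by
  have h := hc k
  have e : ∀ n, ‖c n‖ₑ * ENNReal.ofReal ((k : ℝ) ^ n / Real.sqrt n.factorial) =
      ENNReal.ofReal (‖c n‖ * ((k : ℝ) ^ n / Real.sqrt n.factorial)) := fun n => by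
    rw [ENNReal.ofReal_mul (norm_nonneg _), ofReal_norm]
  simp_rw [e] at h
  have := ENNReal.summable_toReal h.ne
  refine this.congr fun n => ?_
  rw [ENNReal.toReal_ofReal (by positivity)]

theorem norm_term_le {c : ℕ → ℂ} {z : ℂ} {k : ℕ} (hz : ‖z‖ ≤ k) (n : ℕ) :
    ‖c n * (z ^ n / (Real.sqrt (n.factorial : ℝ) : ℂ))‖ ≤
      ‖c n‖ * ((k : ℝ) ^ n / Real.sqrt n.factorial) := by
  rw [norm_mul, norm_div, norm_pow, Complex.norm_real, Real.norm_of_nonneg (Real.sqrt_nonneg _)]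
  gcongr

theorem hasSum_entireSum {c : ℕ → ℂ} (hc : c ∈ entireCoeffs) (z : ℂ) :
    HasSum (fun n => c n * (z ^ n / (Real.sqrt (n.factorial : ℝ) : ℂ))) (entireSum c z) := by
  rw [entireSum, if_pos hc]
  obtain ⟨k, hk⟩ := exists_nat_ge ‖z‖
  exact (Summable.of_norm_bounded (summable_of_mem_entireCoeffs hc k) (norm_term_le hk)).hasSum

theorem differentiable_entireSum (c : ℕ → ℂ) : Differentiable ℂ (entireSum c) := by
  by_cases hc : c ∈ entireCoeffs
  · intro z
    obtain ⟨k, hk⟩ := exists_nat_gt ‖z‖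
    have h := Complex.differentiableOn_tsum_of_summable_norm
      (F := fun n z => c n * (z ^ n / (Real.sqrt (n.factorial : ℝ) : ℂ)))
      (summable_of_mem_entireCoeffs hc k) (fun n => by fun_prop)
      (Metric.isOpen_ball (x := (0 : ℂ)) (ε := k))
      (fun n w hw => norm_term_le (by simpa using (mem_ball_zero_iff.1 hw).le) n)
    have hz : Metric.ball (0 : ℂ) k ∈ 𝓝 z := Metric.isOpen_ball.mem_nhds (by simpa using hk)
    have e : entireSum c = fun z => ∑' n, c n * (z ^ n / (Real.sqrt (n.factorial : ℝ) : ℂ)) := by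
      funext z; rw [entireSum, if_pos hc]
    rw [e]
    exact h.differentiableAt hz
  · have e : entireSum c = fun _ => 0 := by
      funext z; rw [entireSum, if_neg hc]
    rw [e]; fun_prop

theorem measurable_entireSum : Measurable fun p : (ℕ → ℂ) × ℂ => entireSum p.1 p.2 := by
  classical
  refine measurable_of_tendsto_metrizable (f := fun (N : ℕ) (p : (ℕ → ℂ) × ℂ) =>
    if p.1 ∈ entireCoeffs then
      ∑ n ∈ Finset.range N, p.1 n * (p.2 ^ n / (Real.sqrt (n.factorial : ℝ) : ℂ)) else 0)
    (fun N => ?_) (tendsto_pi_nhds.2 fun p => ?_)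
  · refine Measurable.ite (measurable_fst measurableSet_entireCoeffs) ?_ measurable_const
    fun_prop
  · by_cases hp : p.1 ∈ entireCoeffs
    · simpa only [hp, if_true] using (hasSum_entireSum hp p.2).tendsto_sum_nat
    · simp only [hp, if_false, entireSum]
      exact tendsto_const_nhds

theorem measurable_entireSum_comp {α : Type*} [MeasurableSpace α] {η : α → ℕ → ℂ} {g : α → ℂ}
    (hη : Measurable η) (hg : Measurable g) : Measurable fun a => entireSum (η a) (g a) := by
  have h := measurable_entireSum.comp (hη.prodMk hg)
  simpa only [Function.comp_def] using h

theorem summable_pow_div_sqrt_factorial (x : ℝ) (hx : 0 ≤ x) :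
    Summable fun n : ℕ => x ^ n / Real.sqrt n.factorial := by
  -- By the inequality of arithmetic and geometric means, `xⁿ / √n!` is at most the mean of
  -- `(2x²)ⁿ / n!` and `2⁻ⁿ`.
  have h1 := Real.summable_pow_div_factorial (2 * x ^ 2)
  have h2 : Summable fun n : ℕ => ((1 : ℝ) / 2) ^ n := summable_geometric_two
  refine Summable.of_nonneg_of_le (fun n => by positivity) (fun n => ?_) (h1.add h2)
  have hs := Real.sq_sqrt (Nat.cast_nonneg (α := ℝ) n.factorial)
  have hp : (2 * x ^ 2) ^ n / n.factorial * ((1 : ℝ) / 2) ^ n =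
      (x ^ n / Real.sqrt n.factorial) ^ 2 := by
    rw [div_pow (x ^ n), hs, div_mul_eq_mul_div, ← mul_pow, ← pow_mul, mul_comm n 2, pow_mul]
    congr 2; ring
  have ha : 0 ≤ (2 * x ^ 2) ^ n / n.factorial := by positivity
  have hb : 0 ≤ ((1 : ℝ) / 2) ^ n := by positivity
  refine abs_le_of_sq_le_sq' ?_ (add_nonneg ha hb) |>.2
  rw [← hp]
  nlinarith

/-- Random coefficients bounded in mean almost surely give an entire function. -/
theorem ae_mem_entireCoeffs {Ω : Type*} [MeasurableSpace Ω] {μ : Measure Ω} {η : ℕ → Ω → ℂ}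
    (hm : ∀ n, Measurable (η n)) {M : ℝ≥0∞} (hM : M ≠ ∞) (h : ∀ n, ∫⁻ ω, ‖η n ω‖ₑ ∂μ ≤ M) :
    ∀ᵐ ω ∂μ, (fun n => η n ω) ∈ entireCoeffs := by
  simp only [entireCoeffs, Set.mem_ofPred_eq, ae_all_iff]
  intro k
  refine ae_lt_top (by fun_prop) ?_
  rw [lintegral_tsum fun n => by fun_prop]
  refine ne_top_of_le_ne_top
    (b := M * ∑' n : ℕ, ENNReal.ofReal ((k : ℝ) ^ n / Real.sqrt n.factorial))
    (ENNReal.mul_ne_top hM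
      (summable_pow_div_sqrt_factorial k (by positivity)).tsum_ofReal_ne_top) ?_
  rw [← ENNReal.tsum_mul_left]
  refine ENNReal.tsum_le_tsum fun n => ?_
  rw [lintegral_mul_const _ (by fun_prop)]
  gcongr
  exact h n

theorem lintegral_enorm_coeFn_le_Lp {Ω : Type*} [MeasurableSpace Ω] {μ : Measure Ω}
    [IsProbabilityMeasure μ] (f : Lp ℂ 2 μ) : ∫⁻ ω, ‖f ω‖ₑ ∂μ ≤ ENNReal.ofReal ‖f‖ := by
  rw [← eLpNorm_one_eq_lintegral_enorm, Lp.norm_def, ENNReal.ofReal_toReal (Lp.memLp f).2.ne]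
  exact eLpNorm_le_eLpNorm_of_exponent_le (by norm_num) (Lp.aestronglyMeasurable f)

theorem hasSum_normalized {c : ℕ → ℂ} {f : ℂ → ℂ} {z : ℂ}
    (h : HasSum (fun n => c n * (z ^ n / (Real.sqrt (n.factorial : ℝ) : ℂ))) (f z)) :
    HasSum (fun n => c n * fockMonomial n z) (normalized f z) := by
  refine (h.mul_right ((Real.exp (-(‖z‖ ^ 2) / 2) : ℝ) : ℂ)).congr_fun fun n => ?_
  simp only [fockMonomial]; ring

end Series

section RandomSeries

variable {Ω : Type*} [MeasurableSpace Ω] {μ : Measure Ω}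
variable {E H : Type*} [NormedAddCommGroup E] [InnerProductSpace ℂ E]
  [NormedAddCommGroup H] [InnerProductSpace ℂ H]

/-- The random entire function obtained from a process `X` on `E` along a linear map `L` from the
Fock space: its coefficients are the random variables `X (L (e n))`. -/
noncomputable def randomEntire (X : E →ₗᵢ[ℂ] Lp ℂ 2 μ) (e : HilbertBasis ℕ ℂ H) (L : H →L[ℂ] E)
    (ω : Ω) : ℂ → ℂ :=
  entireSum fun n => X (L (e n)) ω

variable (X : E →ₗᵢ[ℂ] Lp ℂ 2 μ) (e : HilbertBasis ℕ ℂ H) (L : H →L[ℂ] E)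

theorem measurable_randomEntire :
    Measurable fun p : Ω × ℂ => randomEntire X e L p.1 p.2 := by
  have h : Measurable fun (p : Ω × ℂ) (n : ℕ) => X (L (e n)) p.1 := by
    refine measurable_pi_iff.2 fun n => ?_
    exact (Lp.stronglyMeasurable (X (L (e n)))).measurable.comp measurable_fst
  unfold randomEntire
  exact measurable_entireSum_comp h measurable_snd

variable [IsProbabilityMeasure μ]

theorem ae_mem_entireCoeffs_randomEntire :
    ∀ᵐ ω ∂μ, (fun n => X (L (e n)) ω) ∈ entireCoeffs := by
  refine ae_mem_entireCoeffs (fun n => (Lp.stronglyMeasurable _).measurable)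
    (M := ENNReal.ofReal ‖L‖) ENNReal.ofReal_ne_top fun n => ?_
  refine (lintegral_enorm_coeFn_le_Lp _).trans (ENNReal.ofReal_le_ofReal ?_)
  rw [LinearIsometry.norm_map]
  simpa [e.orthonormal.1 n] using L.le_opNorm (e n)

/-- At a fixed point `z` the normalized random entire function is the random variable attached to
the vector `L (fockVector e z)`. -/
theorem normalized_randomEntire (z : ℂ) :
    ∀ᵐ ω ∂μ, normalized (randomEntire X e L ω) z = X (L (fockVector e z)) ω := by
  have h : HasSum (fun n => fockMonomial n z • X (L (e n))) (X (L (fockVector e z))) := by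
    have := (hasSum_fockVector e z).mapL (X.toContinuousLinearMap.comp L)
    simpa using this
  have h1 : ∀ᵐ ω ∂μ, ∀ n, (fockMonomial n z • X (L (e n)) : Lp ℂ 2 μ) ω =
      fockMonomial n z * X (L (e n)) ω := by
    rw [ae_all_iff]
    intro n
    filter_upwards [Lp.coeFn_smul (fockMonomial n z) (X (L (e n)))] with ω h
    rw [h, Pi.smul_apply, smul_eq_mul]
  refine (ae_eq_of_hasSum_Lp h ?_).symm
  filter_upwards [h1, ae_mem_entireCoeffs_randomEntire X e L] with ω hω hc
  simp only [hω]
  refine (hasSum_normalized (hasSum_entireSum hc z)).congr_fun fun n => ?_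
  ring

variable {X} in
theorem lintegral_normalized_randomEntire (hX : IsIsonormal X) {k : ℕ} (hk : k ≠ 0) (z : ℂ) :
    ∫⁻ ω, ‖normalized (randomEntire X e L ω) z‖ₑ ^ (2 * k) ∂μ =
      ‖L (fockVector e z)‖ₑ ^ (2 * k) * k.factorial := by
  rw [← hX.lintegral_enorm_pow _ hk]
  refine lintegral_congr_ae ?_
  filter_upwards [normalized_randomEntire X e L z] with ω h
  rw [h]

variable {X e L} in
theorem isGEF_randomEntire (hX : IsIsonormal X) (hL : Orthonormal ℂ fun n => L (e n)) :
    IsGEF (randomEntire X e L) μ where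
  measurable_eval z := by
    have h : Measurable fun ω : Ω => (ω, z) := by fun_prop
    have h2 := (measurable_randomEntire X e L).comp h
    simpa only [Function.comp_def] using h2
  exists_coeff := by
    refine ⟨fun n => X (L (e n)), fun n => (Lp.stronglyMeasurable _).measurable,
      fun n => hX.map_eq_std (hL.1 n), hX.iIndepFun_of_orthonormal hL, ?_⟩
    filter_upwards [ae_mem_entireCoeffs_randomEntire X e L] with ω hω
    exact hasSum_entireSum hω

variable {X e} in
theorem iIndepFun_randomEntire (hX : IsIsonormal X) {ι : Type*} {L : ι → H →L[ℂ] E}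
    (hL : Orthonormal ℂ fun p : (_ : ι) × ℕ => L p.1 (e p.2)) :
    iIndepFun (fun j => randomEntire X e (L j)) μ := by
  have h := iIndepFun_curry (Y := fun j n => (X (L j (e n)) : Ω → ℂ))
    (fun j n => (Lp.stronglyMeasurable _).measurable) (hX.iIndepFun_of_orthonormal hL)
  exact h.comp (fun _ => entireSum) fun _ => measurable_pi_iff.2 fun z =>
    measurable_entireSum_comp measurable_id measurable_const

end RandomSeries

/-! ### Maxima of random entire functions -/

section MeanValue

/-- The sub-mean value property of `|f|ᵐ` on circles. -/
theorem enorm_pow_le_lintegral_circle {f : ℂ → ℂ} (hf : Differentiable ℂ f) (m : ℕ) (r : ℝ) :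
    ENNReal.ofReal (2 * Real.pi) * ‖f 0‖ₑ ^ m ≤
      ∫⁻ θ in Set.Ioo (-Real.pi) Real.pi, ‖f (circleMap 0 r θ)‖ₑ ^ m := by
  have hd : DiffContOnCl ℂ (fun z => f z ^ m) (Metric.ball 0 |r|) := (hf.pow m).diffContOnCl
  have h := hd.circleAverage
  rw [Real.circleAverage_def] at h
  have hper : Function.Periodic (fun θ => f (circleMap 0 r θ) ^ m) (2 * Real.pi) := fun θ => by
    simp only [periodic_circleMap 0 r θ]
  have h1 := hper.intervalIntegral_add_eq 0 (-Real.pi)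
  rw [zero_add, show -Real.pi + 2 * Real.pi = Real.pi by ring] at h1
  have h2 : (2 * Real.pi : ℝ) • f 0 ^ m =
      ∫ θ in Set.Ioc (-Real.pi) Real.pi, f (circleMap 0 r θ) ^ m := by
    rw [← intervalIntegral.integral_of_le (by linarith [Real.pi_pos]), ← h1, ← h, smul_smul,
      mul_inv_cancel₀ (by positivity), one_smul]
  have h3 : ENNReal.ofReal (2 * Real.pi) * ‖f 0‖ₑ ^ m = ‖(2 * Real.pi : ℝ) • f 0 ^ m‖ₑ := by
    rw [enorm_smul, enorm_pow, Real.enorm_of_nonneg (by positivity)]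
  rw [h3, h2, integral_Ioc_eq_integral_Ioo]
  refine (enorm_integral_le_lintegral_enorm _).trans (le_of_eq ?_)
  simp only [enorm_pow]

/-- The sub-mean value property of `|f|ᵐ` on the unit disc. -/
theorem enorm_pow_le_lintegral_ball {f : ℂ → ℂ} (hf : Differentiable ℂ f) (m : ℕ) :
    ENNReal.ofReal Real.pi * ‖f 0‖ₑ ^ m ≤ ∫⁻ z in Metric.ball (0 : ℂ) 1, ‖f z‖ₑ ^ m := by
  have hfm : Measurable f := hf.continuous.measurable
  rw [← lintegral_indicator Metric.isOpen_ball.measurableSet, lintegral_complex_polar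
    ((hfm.enorm.pow_const m).indicator Metric.isOpen_ball.measurableSet)]
  have h1 : ∫⁻ r in Set.Ioo (0 : ℝ) 1, ENNReal.ofReal r *
      (ENNReal.ofReal (2 * Real.pi) * ‖f 0‖ₑ ^ m) = ENNReal.ofReal Real.pi * ‖f 0‖ₑ ^ m := by
    rw [lintegral_mul_const _ (by fun_prop), ← mul_assoc]
    congr 1
    have h2 : ∫⁻ r in Set.Ioo (0 : ℝ) 1, ENNReal.ofReal r = ENNReal.ofReal (1 / 2) := by
      rw [← ofReal_integral_eq_lintegral_ofReal, ← integral_Ioc_eq_integral_Ioo,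
        ← intervalIntegral.integral_of_le zero_le_one, integral_id]
      · norm_num
      · exact (continuous_id.integrableOn_Icc (a := (0 : ℝ)) (b := 1)).mono_set
          Set.Ioo_subset_Icc_self
      · exact (ae_restrict_iff' measurableSet_Ioo).2 (ae_of_all _ fun r hr => hr.1.le)
    rw [h2, ← ENNReal.ofReal_mul (by norm_num)]
    congr 1; ring
  rw [← h1, ← lintegral_indicator measurableSet_Ioo, ← lintegral_indicator measurableSet_Ioi]
  refine lintegral_mono fun r => ?_
  by_cases hr : r ∈ Set.Ioo (0 : ℝ) 1
  · rw [Set.indicator_of_mem hr, Set.indicator_of_mem (Set.mem_Ioi.2 hr.1)]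
    gcongr
    refine (enorm_pow_le_lintegral_circle hf m r).trans (lintegral_mono fun θ => ?_)
    rw [Set.indicator_of_mem]
    simp [abs_of_pos hr.1, hr.2]
  · rw [Set.indicator_of_notMem hr]
    exact zero_le

/-- The sub-mean value property for the normalized function: multiplication by
`exp (- conj z * v)` translates the Gaussian weight to the point `z`. -/
theorem enorm_normalized_pow_le {f : ℂ → ℂ} (hf : Differentiable ℂ f) (k : ℕ) (z : ℂ) :
    ENNReal.ofReal Real.pi * ‖normalized f z‖ₑ ^ (2 * k) ≤
      ENNReal.ofReal (Real.exp k) *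
        ∫⁻ w in Metric.ball z 1, ‖normalized f w‖ₑ ^ (2 * k) := by
  set h : ℂ → ℂ := fun v =>
    f (z + v) * Complex.exp (-(starRingEnd ℂ z * v) - ((‖z‖ ^ 2 / 2 : ℝ) : ℂ)) with hh
  have hd : Differentiable ℂ h := by
    have : Differentiable ℂ fun v => f (z + v) := hf.comp (by fun_prop)
    fun_prop
  have hn : ∀ v, ‖h v‖ = ‖normalized f (z + v)‖ * Real.exp (‖v‖ ^ 2 / 2) := by
    intro v
    rw [hh, normalized, norm_mul, norm_mul, Complex.norm_exp, Complex.norm_real,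
      Real.norm_of_nonneg (Real.exp_pos _).le, mul_assoc, ← Real.exp_add]
    congr 2
    rw [← Complex.normSq_eq_norm_sq, ← Complex.normSq_eq_norm_sq, ← Complex.normSq_eq_norm_sq,
      Complex.normSq_apply, Complex.normSq_apply, Complex.normSq_apply]
    simp
    ring
  have h0 : ‖h 0‖ₑ = ‖normalized f z‖ₑ := by
    rw [← ofReal_norm, hn, add_zero]; simp
  have hcont : Continuous (normalized f) := by
    have := hf.continuous
    unfold normalized; fun_prop
  have hm : Measurable fun w => ‖normalized f w‖ₑ ^ (2 * k) := by fun_prop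
  rw [← h0]
  refine (enorm_pow_le_lintegral_ball hd _).trans ?_
  have hsub : ∫⁻ v in Metric.ball (0 : ℂ) 1, ‖normalized f (z + v)‖ₑ ^ (2 * k) =
      ∫⁻ w in Metric.ball z 1, ‖normalized f w‖ₑ ^ (2 * k) := by
    rw [← lintegral_indicator Metric.isOpen_ball.measurableSet,
      ← lintegral_indicator Metric.isOpen_ball.measurableSet,
      ← lintegral_add_left_eq_self ((Metric.ball z 1).indicator _) z]
    refine lintegral_congr fun v => ?_
    by_cases hv : v ∈ Metric.ball (0 : ℂ) 1
    · have hv' : z + v ∈ Metric.ball z 1 := by simpa using hv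
      rw [Set.indicator_of_mem hv, Set.indicator_of_mem hv']
    · have hv' : z + v ∉ Metric.ball z 1 := by simpa using hv
      rw [Set.indicator_of_notMem hv, Set.indicator_of_notMem hv']
  have hm' : Measurable fun v => ‖normalized f (z + v)‖ₑ ^ (2 * k) :=
    hm.comp (measurable_const_add z)
  rw [← hsub, ← lintegral_const_mul _ hm']
  refine setLIntegral_mono (hm'.const_mul _) fun v hv => ?_
  have hv1 : ‖v‖ < 1 := by simpa using hv
  have e1 : ‖h v‖ₑ = ‖normalized f (z + v)‖ₑ * ENNReal.ofReal (Real.exp (‖v‖ ^ 2 / 2)) := by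
    rw [← ofReal_norm, hn, ENNReal.ofReal_mul (norm_nonneg _), ofReal_norm]
  rw [e1, mul_pow, mul_comm]
  gcongr
  rw [← ENNReal.ofReal_pow (Real.exp_pos _).le, ← Real.exp_nat_mul]
  refine ENNReal.ofReal_le_ofReal (Real.exp_le_exp.2 ?_)
  push_cast
  have : ‖v‖ ^ 2 ≤ 1 := by nlinarith [norm_nonneg v]
  nlinarith [(Nat.cast_nonneg k : (0 : ℝ) ≤ k)]

end MeanValue

/-- Pointwise moment bounds on the unit neighbourhood of `K` bound the maximum over `K`. -/
theorem measure_exists_normalized_ge_le {Ω : Type*} [MeasurableSpace Ω] {μ : Measure Ω}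
    [SFinite μ] {G : Ω → ℂ → ℂ} (hG : Measurable fun p : Ω × ℂ => G p.1 p.2)
    (hd : ∀ ω, Differentiable ℂ (G ω)) {K : Set ℂ} {z₀ : ℂ} {r : ℝ} (hr : 0 ≤ r)
    (hK : K ⊆ Metric.closedBall z₀ r) {k : ℕ} {M : ℝ≥0∞}
    (hM : ∀ w ∈ Metric.thickening 1 K, ∫⁻ ω, ‖normalized (G ω) w‖ₑ ^ (2 * k) ∂μ ≤ M)
    {t : ℝ} (ht : 0 < t) :
    μ {ω | ∃ z ∈ K, t ≤ ‖normalized (G ω) z‖} ≤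
      ENNReal.ofReal (Real.exp k * (r + 1) ^ 2 / t ^ (2 * k)) * M := by
  set Q : Ω → ℝ≥0∞ := fun ω => ∫⁻ w in Metric.thickening 1 K, ‖normalized (G ω) w‖ₑ ^ (2 * k)
    with hQ
  have hjm : Measurable fun p : Ω × ℂ => ‖normalized (G p.1) p.2‖ₑ ^ (2 * k) := by
    unfold normalized; fun_prop
  have hQm : Measurable Q := hjm.lintegral_prod_right'
  have hvol : volume (Metric.thickening 1 K) ≤ ENNReal.ofReal (Real.pi * (r + 1) ^ 2) := by
    have hsub : Metric.thickening 1 K ⊆ Metric.ball z₀ (r + 1) := by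
      intro w hw
      obtain ⟨z, hz, hwz⟩ := Metric.mem_thickening_iff.1 hw
      have := Metric.mem_closedBall.1 (hK hz)
      rw [Metric.mem_ball]
      linarith [dist_triangle w z z₀]
    refine (measure_mono hsub).trans (le_of_eq ?_)
    have hpi : (NNReal.pi : ℝ≥0∞) = ENNReal.ofReal Real.pi :=
      (ENNReal.ofReal_coe_nnreal (p := NNReal.pi)).symm
    rw [Complex.volume_ball, hpi, ENNReal.ofReal_mul Real.pi_pos.le,
      ENNReal.ofReal_pow (by linarith), mul_comm]
  have hEQ : ∫⁻ ω, Q ω ∂μ ≤ ENNReal.ofReal (Real.pi * (r + 1) ^ 2) * M := by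
    rw [hQ, lintegral_lintegral_swap hjm.aemeasurable]
    refine (setLIntegral_mono measurable_const hM).trans ?_
    rw [setLIntegral_const, mul_comm]
    gcongr
  have hsub : {ω | ∃ z ∈ K, t ≤ ‖normalized (G ω) z‖} ⊆
      {ω | ENNReal.ofReal (Real.pi * t ^ (2 * k) / Real.exp k) ≤ Q ω} := by
    rintro ω ⟨z, hz, hzt⟩
    have h1 := enorm_normalized_pow_le (hd ω) k z
    have h2 : ∫⁻ w in Metric.ball z 1, ‖normalized (G ω) w‖ₑ ^ (2 * k) ≤ Q ω :=
      lintegral_mono_set fun w hw => Metric.mem_thickening_iff.2 ⟨z, hz, hw⟩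
    have h3 : ENNReal.ofReal (Real.pi * t ^ (2 * k)) ≤ ENNReal.ofReal (Real.exp k) * Q ω := by
      refine le_trans ?_ (h1.trans (by gcongr))
      rw [ENNReal.ofReal_mul Real.pi_pos.le, ENNReal.ofReal_pow ht.le]
      gcongr
      rw [← ofReal_norm]
      exact ENNReal.ofReal_le_ofReal hzt
    rw [Set.mem_ofPred_eq, ENNReal.ofReal_div_of_pos (Real.exp_pos _)]
    refine ENNReal.div_le_of_le_mul ?_
    rwa [mul_comm (Q ω)]
  refine (measure_mono hsub).trans ?_
  have hpos : 0 < Real.pi * t ^ (2 * k) / Real.exp k := by positivity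
  refine (meas_ge_le_lintegral_div hQm.aemeasurable (by simpa using hpos)
    ENNReal.ofReal_ne_top).trans ?_
  refine ENNReal.div_le_of_le_mul (hEQ.trans (le_of_eq ?_))
  rw [mul_right_comm, ← ENNReal.ofReal_mul (by positivity)]
  congr 2
  field_simp

/-! ### Geometry and numerical estimates -/

section Geometry

/-- By connectedness, the plane is not the union of several disjoint non-empty open sets. -/
theorem exists_forall_notMem_of_disjoint_open {ι : Type*} {U : ι → Set ℂ}
    (ho : ∀ j, IsOpen (U j)) (hne : ∀ j, (U j).Nonempty)
    (hdis : ∀ j k, j ≠ k → Disjoint (U j) (U k)) (hι : ¬ Subsingleton ι) :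
    ∃ p, ∀ j, p ∉ U j := by
  obtain ⟨j, k, hjk⟩ := not_subsingleton_iff_nontrivial.1 hι
  by_contra! hcov
  have hcompl : (U j)ᶜ = ⋃ i ∈ {i | i ≠ j}, U i := by
    ext z
    simp only [Set.mem_compl_iff, Set.mem_iUnion, Set.mem_ofPred_eq, exists_prop]
    refine ⟨fun hz => ?_, fun ⟨i, hi, hz⟩ hz' => (hdis i j hi).notMem_of_mem_left hz hz'⟩
    obtain ⟨i, hi⟩ := hcov z
    exact ⟨i, fun h => hz (h ▸ hi), hi⟩
  have hclopen : IsClopen (U j) :=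
    ⟨⟨hcompl ▸ isOpen_biUnion fun i _ => ho i⟩, ho j⟩
  rcases isClopen_iff.1 hclopen with h | h
  · exact (hne j).ne_empty h
  · obtain ⟨z, hz⟩ := hne k
    exact (hdis j k hjk).notMem_of_mem_right hz (h ▸ Set.mem_univ z)

/-- The left side is the bound of `measure_exists_normalized_ge_le` for a set of diameter at most
`l`, the level `(2 * l)⁻¹`, and Gaussians of standard deviation `2 * l⁻⁸`. -/
theorem moment_bound_le_exp {l : ℝ} (hl : 2 ≤ l) {k : ℕ} (hk : k = ⌈l⌉₊) :
    Real.exp k * (l + 1) ^ 2 / ((2 * l)⁻¹) ^ (2 * k) *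
      ((2 * (l ^ 8)⁻¹) ^ (2 * k) * k.factorial) ≤ Real.exp (-l) := by
  have hl0 : 0 < l := by linarith
  have hk1 : l ≤ k := hk ▸ Nat.le_ceil l
  have hk2 : (k : ℝ) ≤ 2 * l := by
    have := Nat.ceil_lt_add_one hl0.le
    rw [← hk] at this
    linarith
  have hfac : (k.factorial : ℝ) ≤ (2 * l) ^ k := by
    have : (k.factorial : ℝ) ≤ (k : ℝ) ^ k := by exact_mod_cast Nat.factorial_le_pow k
    exact this.trans (by gcongr)
  -- After `k! ≤ (2 * l) ^ k` the bound is `(l + 1)²` times the `k`-th power of this base.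
  have hbase : Real.exp 1 * 32 * (l ^ 13)⁻¹ ≤ Real.exp (-3) := by
    have h1 : (2 : ℝ) ^ 13 ≤ l ^ 13 := by gcongr
    have h2 : Real.exp 1 * 32 ≤ Real.exp (-3) * l ^ 13 := by
      have h3 : Real.exp 1 ^ 4 ≤ 3 ^ 4 := by
        gcongr
        linarith [Real.exp_one_lt_d9]
      have h4 : Real.exp 1 = Real.exp (-3) * Real.exp 1 ^ 4 := by
        rw [← Real.exp_nat_mul, ← Real.exp_add]; norm_num
      rw [h4, mul_assoc]
      gcongr
      nlinarith
    rw [← div_eq_mul_inv, div_le_iff₀ (by positivity)]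
    exact h2
  have hexp : l + 1 ≤ Real.exp l := Real.add_one_le_exp l
  calc Real.exp k * (l + 1) ^ 2 / ((2 * l)⁻¹) ^ (2 * k) *
        ((2 * (l ^ 8)⁻¹) ^ (2 * k) * k.factorial)
      ≤ Real.exp k * (l + 1) ^ 2 / ((2 * l)⁻¹) ^ (2 * k) *
        ((2 * (l ^ 8)⁻¹) ^ (2 * k) * (2 * l) ^ k) := by gcongr
    _ = (l + 1) ^ 2 * (Real.exp 1 * 32 * (l ^ 13)⁻¹) ^ k := by
        rw [show Real.exp k = Real.exp 1 ^ k by rw [← Real.exp_nat_mul, mul_one],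
          pow_mul _ 2 k, pow_mul _ 2 k]
        have : Real.exp 1 * 32 * (l ^ 13)⁻¹ =
            Real.exp 1 * ((((2 * l)⁻¹) ^ 2)⁻¹ * ((2 * (l ^ 8)⁻¹) ^ 2 * (2 * l))) := by
          field_simp
          norm_num
        rw [this]
        generalize ((2 * l)⁻¹) ^ 2 = a
        generalize (2 * (l ^ 8)⁻¹) ^ 2 = b
        generalize 2 * l = d
        rw [mul_pow (Real.exp 1), mul_pow, mul_pow b d, inv_pow]
        ring
    _ ≤ Real.exp l ^ 2 * Real.exp (-3) ^ k := by gcongr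
    _ ≤ Real.exp (-l) := by
        rw [← Real.exp_nat_mul, ← Real.exp_nat_mul, ← Real.exp_add]
        refine Real.exp_le_exp.2 ?_
        push_cast
        linarith

end Geometry

theorem normalized_sub (f g : ℂ → ℂ) (z : ℂ) :
    normalized (f - g) z = normalized f z - normalized g z := by
  simp only [normalized, Pi.sub_apply]; ring

section Coupling

variable {Ω : Type*} [MeasurableSpace Ω] {μ : Measure Ω} [IsProbabilityMeasure μ]
variable {E H : Type*} [NormedAddCommGroup E] [InnerProductSpace ℂ E]
  [NormedAddCommGroup H] [InnerProductSpace ℂ H]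

/-- The difference of the given Gaussian entire function and the one built from the extended
process along `L`: the direction of the vector attached to `p`, which was altered to make room
for new randomness, contributes a multiple of the kernel at `p`. -/
theorem ae_normalized_sub_randomEntire {F : Ω → ℂ → ℂ} {ζ : ℕ → Ω → ℂ}
    (hF : ∀ᵐ ω ∂μ, ∀ z : ℂ,
      HasSum (fun n : ℕ => ζ n ω * (z ^ n / (Real.sqrt (n.factorial : ℝ) : ℂ))) (F ω z))
    {e : HilbertBasis ℕ ℂ H} {X : H →ₗᵢ[ℂ] Lp ℂ 2 μ} (hXe : ∀ n, X (e n) =ᵐ[μ] ζ n)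
    {X' : E →ₗᵢ[ℂ] Lp ℂ 2 μ} {V : H →ₗᵢ[ℂ] E} {p : ℂ}
    (hext : ∀ h, X h - X' (V h) =
      inner ℂ (fockVector e p) h • (X (fockVector e p) - X' (V (fockVector e p))))
    (L : H →L[ℂ] E) :
    ∀ᵐ ω ∂μ, ∀ z, normalized (F ω - randomEntire X' e L ω) z =
      (X (fockVector e p) ω - X' (V (fockVector e p)) ω) * fockKernel p z +
        normalized (randomEntire X' e (V.toContinuousLinearMap - L) ω) z := by
  set D := V.toContinuousLinearMap - L with hD
  set c := fockVector e p with hc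
  have hcoef : ∀ᵐ ω ∂μ, ∀ n, ζ n ω = X' (L (e n)) ω +
      (starRingEnd ℂ (fockMonomial n p) * (X c ω - X' (V c) ω) + X' (D (e n)) ω) := by
    rw [ae_all_iff]
    intro n
    have h1 : X (e n) = X' (L (e n)) + (starRingEnd ℂ (fockMonomial n p) • (X c - X' (V c)) +
        X' (D (e n))) := by
      have h2 := hext (e n)
      rw [← inner_conj_symm, hc, inner_fockVector, ← hc] at h2
      rw [← h2, hD]
      simp
    filter_upwards [hXe n, Lp.coeFn_add (X' (L (e n)))
      (starRingEnd ℂ (fockMonomial n p) • (X c - X' (V c)) + X' (D (e n))),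
      Lp.coeFn_add (starRingEnd ℂ (fockMonomial n p) • (X c - X' (V c))) (X' (D (e n))),
      Lp.coeFn_smul (starRingEnd ℂ (fockMonomial n p)) (X c - X' (V c)),
      Lp.coeFn_sub (X c) (X' (V c))] with ω h2 h3 h4 h5 h6
    rw [← h2, h1, h3, Pi.add_apply, h4, Pi.add_apply, h5, Pi.smul_apply, h6, Pi.sub_apply,
      smul_eq_mul]
  filter_upwards [hF, hcoef, ae_mem_entireCoeffs_randomEntire X' e L,
    ae_mem_entireCoeffs_randomEntire X' e D] with ω hω hco hL hDc z
  have s1 := hasSum_normalized (hω z)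
  have s2 := hasSum_normalized (hasSum_entireSum hL z)
  have s3 := hasSum_normalized (hasSum_entireSum hDc z)
  have s4 := (hasSum_fockKernel p z).mul_left (X c ω - X' (V c) ω)
  have s5 := (s2.add (s4.add s3)).congr_fun (g := fun n => ζ n ω * fockMonomial n z) fun n => by
    rw [hco n]; ring
  rw [normalized_sub, s1.unique s5]
  unfold randomEntire
  ring

end Coupling

/-! ### Almost independence -/

section Estimate

variable {Ω : Type*} [MeasurableSpace Ω] {μ : Measure Ω} [IsProbabilityMeasure μ]
variable {E H : Type*} [NormedAddCommGroup E] [InnerProductSpace ℂ E]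
  [NormedAddCommGroup H] [InnerProductSpace ℂ H]

theorem IsIsonormal.measure_norm_ge {X : E →ₗᵢ[ℂ] Lp ℂ 2 μ} (hX : IsIsonormal X) {v : E}
    (hv : ‖v‖ = 1) {t : ℝ} (ht : 0 ≤ t) :
    μ {ω | t ≤ ‖X v ω‖} = ENNReal.ofReal (Real.exp (-t ^ 2)) := by
  rw [← std_tail ht, ← hX.map_eq_std hv, Measure.map_apply
    (Lp.stronglyMeasurable (X v)).measurable (measurableSet_le measurable_const measurable_norm)]
  rfl

/-- Moments of order comparable to `l` turn a variance of order `l⁻¹⁶` on the unit neighbourhood of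
`K` into an exponential bound for the maximum over `K`. -/
theorem measure_exists_randomEntire_ge_le {X : E →ₗᵢ[ℂ] Lp ℂ 2 μ} (hX : IsIsonormal X)
    (e : HilbertBasis ℕ ℂ H) (D : H →L[ℂ] E) {K : Set ℂ} {l : ℝ} (hl : 2 ≤ l)
    (hK : IsCompact K) (hdiam : Metric.diam K ≤ l)
    (hD : ∀ w ∈ Metric.thickening 1 K, ‖D (fockVector e w)‖ ≤ 2 * (l ^ 8)⁻¹) :
    μ {ω | ∃ z ∈ K, (2 * l)⁻¹ ≤ ‖normalized (randomEntire X e D ω) z‖} ≤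
      ENNReal.ofReal (Real.exp (-l)) := by
  rcases K.eq_empty_or_nonempty with rfl | ⟨z₀, hz₀⟩
  · simp
  have hl0 : 0 < l := by linarith
  have hk : ⌈l⌉₊ ≠ 0 := (Nat.ceil_pos.2 hl0).ne'
  have hsub : K ⊆ Metric.closedBall z₀ l := fun z hz =>
    Metric.mem_closedBall.2 ((Metric.dist_le_diam_of_mem hK.isBounded hz hz₀).trans hdiam)
  refine (measure_exists_normalized_ge_le (measurable_randomEntire X e D)
    (fun ω => differentiable_entireSum _) hl0.le hsub (k := ⌈l⌉₊)
    (M := ENNReal.ofReal ((2 * (l ^ 8)⁻¹) ^ (2 * ⌈l⌉₊) * (⌈l⌉₊.factorial : ℝ)))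
    (fun w hw => ?_) (by positivity : 0 < (2 * l)⁻¹)).trans ?_
  · rw [lintegral_normalized_randomEntire e D hX hk, ENNReal.ofReal_mul (by positivity),
      ENNReal.ofReal_natCast, ENNReal.ofReal_pow (by positivity)]
    gcongr
    rw [← ofReal_norm]
    exact ENNReal.ofReal_le_ofReal (hD w hw)
  · rw [← ENNReal.ofReal_mul (by positivity)]
    exact ENNReal.ofReal_le_ofReal (moment_bound_le_exp hl rfl)

/-- The bound for the error term, made of a random multiple of the kernel at a point `p` far from
`K` and of a random entire function whose variance is small near `K`. -/
theorem measureReal_exists_ge_le {G : Ω → ℂ → ℂ} {X : H →ₗᵢ[ℂ] Lp ℂ 2 μ} (hX : IsIsonormal X)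
    {X' : E →ₗᵢ[ℂ] Lp ℂ 2 μ} (hX' : IsIsonormal X') {e : HilbertBasis ℕ ℂ H} {c : H} {c' : E}
    (hc : ‖c‖ = 1) (hc' : ‖c'‖ = 1) {p : ℂ} {D : H →L[ℂ] E}
    (hG : ∀ᵐ ω ∂μ, ∀ z, normalized (G ω) z = (X c ω - X' c' ω) * fockKernel p z +
      normalized (randomEntire X' e D ω) z)
    {K : Set ℂ} {l : ℝ} (hl : 2 ≤ l) (hK : IsCompact K) (hdiam : Metric.diam K ≤ l)
    (hp : ∀ z ∈ K, ‖fockKernel p z‖ ≤ (l ^ 32)⁻¹)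
    (hD : ∀ w ∈ Metric.thickening 1 K, ‖D (fockVector e w)‖ ≤ 2 * (l ^ 8)⁻¹) :
    μ.real {ω | ∃ z ∈ K, l⁻¹ ≤ ‖normalized (G ω) z‖} ≤ 3 * Real.exp (-l) := by
  have hl0 : 0 < l := by linarith
  have hsub : {ω | ∃ z ∈ K, l⁻¹ ≤ ‖normalized (G ω) z‖} ≤ᵐ[μ]
      ({ω | ∃ z ∈ K, (2 * l)⁻¹ ≤ ‖normalized (randomEntire X' e D ω) z‖} ∪
        ({ω | l ≤ ‖X c ω‖} ∪ {ω | l ≤ ‖X' c' ω‖}) : Set Ω) := by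
    filter_upwards [hG] with ω hω ⟨z, hz, hzl⟩
    by_contra h
    have hcon : ω ∉ ({ω | ∃ z ∈ K, (2 * l)⁻¹ ≤ ‖normalized (randomEntire X' e D ω) z‖} ∪
        ({ω | l ≤ ‖X c ω‖} ∪ {ω | l ≤ ‖X' c' ω‖}) : Set Ω) := h
    simp only [Set.mem_union, Set.mem_ofPred_eq, not_or, not_exists, not_and, not_le] at hcon
    obtain ⟨h1, h2, h3⟩ := hcon
    have h4 := h1 z hz
    rw [hω z] at hzl
    have h5 : ‖(X c ω - X' c' ω) * fockKernel p z‖ ≤ (2 * l) * (l ^ 32)⁻¹ := by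
      rw [norm_mul]
      have := norm_sub_le (X c ω) (X' c' ω)
      gcongr
      · linarith
      · exact hp z hz
    have h6 : (2 * l) * (l ^ 32)⁻¹ ≤ (2 * l)⁻¹ := by
      rw [← div_eq_mul_inv, div_le_iff₀ (by positivity), inv_mul_eq_div,
        le_div_iff₀ (by positivity)]
      have : (2 : ℝ) ^ 2 * l ^ 2 ≤ l ^ 30 * l ^ 2 := by
        gcongr
        calc (2 : ℝ) ^ 2 ≤ 2 ^ 30 := by norm_num
          _ ≤ l ^ 30 := by gcongr
      nlinarith
    have h7 : l⁻¹ = (2 * l)⁻¹ + (2 * l)⁻¹ := by field_simp; norm_num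
    have h8 := norm_add_le ((X c ω - X' c' ω) * fockKernel p z)
      (normalized (randomEntire X' e D ω) z)
    linarith
  have htail : ENNReal.ofReal (Real.exp (-l ^ 2)) ≤ ENNReal.ofReal (Real.exp (-l)) :=
    ENNReal.ofReal_le_ofReal (Real.exp_le_exp.2 (by nlinarith))
  have hb : μ {ω | ∃ z ∈ K, l⁻¹ ≤ ‖normalized (G ω) z‖} ≤
      ENNReal.ofReal (3 * Real.exp (-l)) := by
    refine (measure_mono_ae hsub).trans ?_
    have e3 : ENNReal.ofReal (3 * Real.exp (-l)) = ENNReal.ofReal (Real.exp (-l)) +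
        (ENNReal.ofReal (Real.exp (-l)) + ENNReal.ofReal (Real.exp (-l))) := by
      rw [← ENNReal.ofReal_add (by positivity) (by positivity),
        ← ENNReal.ofReal_add (by positivity) (by positivity)]
      congr 1; ring
    rw [e3]
    refine (measure_union_le _ _).trans (add_le_add
      (measure_exists_randomEntire_ge_le hX' e D hl hK hdiam hD) ?_)
    refine (measure_union_le _ _).trans (add_le_add ?_ ?_)
    · rw [hX.measure_norm_ge hc hl0.le]; exact htail
    · rw [hX'.measure_norm_ge hc' hl0.le]; exact htail
  exact ENNReal.toReal_le_of_le_ofReal (by positivity) hb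

end Estimate

/-- Composing an embedding of the Fock space into `L²(ℂ)` with the lift to the graph of `σ`. -/
noncomputable def fockLift {H : Type*} [NormedAddCommGroup H] [InnerProductSpace ℂ H]
    (B : H →ₗᵢ[ℂ] Lp ℂ 2 (volume : Measure ℂ)) {σ : ℂ → ℕ} (hσ : Measurable σ) :
    H →ₗᵢ[ℂ] Lp ℂ 2 ((volume : Measure ℂ).prod (Measure.count : Measure ℕ)) :=
  (graphLift σ hσ).comp B

/-- The Gaussian tails at distance `8 √(log l)`, and at half of it: the unit neighbourhood of `K`
keeps at least the distance `4 √(log l)` from the complement of the `8 √(log l)`-neighbourhood. -/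
theorem exp_half_sq_sqrt_log {l : ℝ} (hl : 2 ≤ l) :
    Real.exp (-(8 * Real.sqrt (Real.log l)) ^ 2 / 2) = (l ^ 32)⁻¹ ∧
      Real.exp (-(4 * Real.sqrt (Real.log l)) ^ 2 / 2) = (l ^ 8)⁻¹ ∧
      1 ≤ 4 * Real.sqrt (Real.log l) := by
  have hl0 : 0 < l := by linarith
  have hlog : Real.log 2 ≤ Real.log l := Real.log_le_log (by norm_num) hl
  have hlog2 := Real.log_two_gt_d9
  have hs := Real.sq_sqrt (show 0 ≤ Real.log l by linarith)
  refine ⟨?_, ?_, ?_⟩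
  · rw [mul_pow, hs, ← Real.exp_log (pow_pos hl0 32), ← Real.exp_neg, Real.log_pow]
    congr 1; push_cast; ring
  · rw [mul_pow, hs, ← Real.exp_log (pow_pos hl0 8), ← Real.exp_neg, Real.log_pow]
    congr 1; push_cast; ring
  · nlinarith [Real.sqrt_nonneg (Real.log l)]

theorem mainTheorem8 :
    ∃ A C : ℝ, 1 < A ∧ 0 < C ∧
      ∀ (Ω : Type*) [MeasurableSpace Ω] (μ : Measure Ω) [IsProbabilityMeasure μ]
        (F : Ω → ℂ → ℂ), IsGEF F μ →
      ∀ (ι : Type*) (K : ι → Set ℂ) (lam : ι → ℝ),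
        (∀ j, IsCompact (K j)) → (∀ j, (K j).Nonempty) →
        (∀ j, max (Metric.diam (K j)) 2 ≤ lam j) →
        (∀ j k, j ≠ k →
          Disjoint (Metric.thickening (A * Real.sqrt (Real.log (lam j))) (K j))
            (Metric.thickening (A * Real.sqrt (Real.log (lam k))) (K k))) →
        ∃ Fj Gj : ι → Ω → ℂ → ℂ,
          (∀ j, IsGEF (Fj j) μ) ∧
          iIndepFun Fj μ ∧
          (∀ j ω, ∀ z ∈ K j,
            normalized (F ω) z = normalized (Fj j ω) z + normalized (Gj j ω) z) ∧
          ∀ j, μ.real {ω | ∃ z ∈ K j, (lam j)⁻¹ ≤ ‖normalized (Gj j ω) z‖}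
            ≤ C * Real.exp (-lam j) := by
  classical
  refine ⟨8, 3, by norm_num, by norm_num, ?_⟩
  intro Ω _ μ _ F hF ι K lam hKc hKne hlam hdis
  -- With at most one set there is nothing to separate, and possibly no point `p` off all the sets.
  by_cases hι : Subsingleton ι
  · refine ⟨fun _ => F, fun _ _ => 0, fun _ => hF, iIndepFun.of_subsingleton, ?_, fun j => ?_⟩
    · intro j ω z _
      simp [normalized]
    · have h2 : 2 ≤ lam j := (le_max_right _ _).trans (hlam j)
      have : {ω : Ω | ∃ z ∈ K j, (lam j)⁻¹ ≤ ‖normalized (0 : ℂ → ℂ) z‖} = ∅ := by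
        ext ω
        simp only [normalized, Pi.zero_apply, zero_mul, norm_zero, Set.mem_ofPred_eq,
          Set.mem_empty_iff_false, iff_false, not_exists, not_and, not_le]
        intro _ _
        positivity
      rw [this, measureReal_empty]
      positivity
  have hlam2 : ∀ j, 2 ≤ lam j := fun j => (le_max_right _ _).trans (hlam j)
  set R : ι → ℝ := fun j => 8 * Real.sqrt (Real.log (lam j)) with hR
  set U : ι → Set ℂ := fun j => Metric.thickening (R j) (K j) with hU
  have hR1 : ∀ j, 2 ≤ R j := fun j => by
    have := (exp_half_sq_sqrt_log (hlam2 j)).2.2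
    simp only [hR]
    linarith
  have hUo : ∀ j, IsOpen (U j) := fun j => Metric.isOpen_thickening
  have hKU : ∀ j, K j ⊆ U j := fun j =>
    Metric.self_subset_thickening (by linarith [hR1 j]) _
  have hUne : ∀ j, (U j).Nonempty := fun j => (hKne j).mono (hKU j)
  have hcount : Countable ι :=
    Pairwise.countable_of_isOpen_disjoint (fun j k hjk => hdis j k hjk) hUo hUne
  obtain ⟨enc, henc⟩ := exists_injective_nat ι
  obtain ⟨p, hp⟩ := exists_forall_notMem_of_disjoint_open hUo hUne hdis hι
  have hfar : ∀ j, ∀ w, w ∉ U j → ∀ z ∈ K j, R j ≤ ‖z - w‖ := fun j w hw z hz => by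
    by_contra! hlt
    refine hw (Metric.mem_thickening_iff.2 ⟨z, hz, ?_⟩)
    rwa [dist_comm, dist_eq_norm]
  obtain ⟨-, ζ, hζm, hζlaw, hζind, hζsum⟩ := hF
  let e : HilbertBasis ℕ ℂ (lp (fun _ : ℕ => ℂ) 2) :=
    HilbertBasis.ofRepr (LinearIsometryEquiv.refl ℂ _)
  obtain ⟨X, hX, hXe⟩ := exists_isonormal e hζm hζlaw hζind
  obtain ⟨B, hB⟩ := exists_bargmann e
  have h0 : Measurable fun _ : ℂ => (0 : ℕ) := measurable_const
  have : Fact ((2 : ℝ≥0∞) ≠ ∞) := ⟨by simp⟩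
  obtain ⟨X', hX', hext⟩ := hX.exists_extension (fockLift B h0) (norm_fockVector e p)
  -- Inside `U j` all the processes share the sheet `0`; outside, each has a sheet of its own.
  let σ : ι → ℂ → ℕ := fun j w => if w ∈ U j then 0 else enc j + 1
  have hσ : ∀ j, Measurable (σ j) := fun j =>
    Measurable.ite (hUo j).measurableSet measurable_const measurable_const
  have hσne : ∀ j k, j ≠ k → ∀ w, σ j w ≠ σ k w := by
    intro j k hjk w
    simp only [σ]
    split_ifs with h1 h2 h2
    · exact absurd h2 ((hdis j k hjk).notMem_of_mem_left h1)
    · exact (Nat.succ_ne_zero _).symm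
    · exact Nat.succ_ne_zero _
    · exact fun h => hjk (henc (Nat.succ_injective h))
  let L : ι → lp (fun _ : ℕ => ℂ) 2 →L[ℂ]
      Lp ℂ 2 ((volume : Measure ℂ).prod (Measure.count : Measure ℕ)) :=
    fun j => (fockLift B (hσ j)).toContinuousLinearMap
  have hL : Orthonormal ℂ fun q : (_ : ι) × ℕ => L q.1 (e q.2) := by
    refine ⟨fun q => ?_, ?_⟩
    · simpa [L] using e.orthonormal.1 q.2
    · rintro ⟨j, m⟩ ⟨k, n⟩ hjk
      by_cases h : j = k
      · subst h
        have hmn : m ≠ n := fun h => hjk (by rw [h])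
        change inner ℂ (fockLift B (hσ j) (e m)) (fockLift B (hσ j) (e n)) = 0
        rw [LinearIsometry.inner_map_map]
        exact e.orthonormal.2 hmn
      · exact inner_graphLift_of_disjoint (hσ j) (hσ k) (hσne j k h) (B (e m)) (B (e n))
  refine ⟨fun j => randomEntire X' e (L j), fun j ω => F ω - randomEntire X' e (L j) ω,
    fun j => isGEF_randomEntire hX' ?_, iIndepFun_randomEntire hX' hL, ?_, fun j => ?_⟩
  · exact hL.comp (fun n => (⟨j, n⟩ : (_ : ι) × ℕ))
      fun a b hab => eq_of_heq (Sigma.mk.inj_iff.1 hab).2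
  · intro j ω z _
    rw [normalized_sub]; ring
  · obtain ⟨hexp1, hexp2, hR4⟩ := exp_half_sq_sqrt_log (hlam2 j)
    refine measureReal_exists_ge_le hX hX' (norm_fockVector e p)
      ((LinearIsometry.norm_map _ _).trans (norm_fockVector e p))
      (ae_normalized_sub_randomEntire hζsum hXe hext (L j)) (hlam2 j) (hKc j)
      ((le_max_left _ _).trans (hlam j)) (fun z hz => ?_) fun w hw => ?_
    · rw [norm_fockKernel, ← hexp1]
      have h1 : R j ≤ ‖z - p‖ := hfar j p (hp j) z hz
      refine Real.exp_le_exp.2 ?_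
      have : (R j) ^ 2 ≤ ‖z - p‖ ^ 2 := by
        have := hR1 j
        gcongr
      simp only [hR] at this
      linarith
    · obtain ⟨z, hz, hwz⟩ := Metric.mem_thickening_iff.1 hw
      change ‖graphLift _ h0 (B (fockVector e w)) - graphLift (σ j) (hσ j) (B (fockVector e w))‖ ≤ _
      refine norm_graphLift_sub_le h0 (hσ j) _ (by positivity) ?_
      rw [← hexp2]
      refine eLpNorm_indicator_bargmann_le (by linarith) (hB w) fun v hv => ?_
      have hv' : v ∉ U j := fun h => hv (by simp [σ, h])
      have h1 := hfar j v hv' z hz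
      have h2 : ‖z - v‖ ≤ ‖v - w‖ + ‖w - z‖ := by
        rw [norm_sub_rev z v]; exact norm_sub_le_norm_sub_add_norm_sub v w z
      rw [dist_eq_norm] at hwz
      simp only [hR] at h1
      linarith
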